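/- Let $k:(0,\infty)\to[0,\infty)$ be integrable, not identically zero, and completely monotonic, i.e. $k(t)=\int_{[0,\infty)}e^{-\tau t}\,d\nu(\tau)$ for all $t>0$, where $\nu$ is a positive Radon measure on $[0,\infty)$. Let $\hat k(z)=\int_0^\infty e^{-zt}k(t)\,dt$ for $\operatorname{Re} z\ge 0$. Let $\Omega=(0,1)$, with $\partial\Omega=\{0,1\}$ carrying the counting measure and $L^2(\partial\Omega)=\mathbb{C}^2$; all function spaces are complex. Let $\Gamma:H^1(\Omega)\to L^2(\partial\Omega)$ be the trace, $\nabla H^1(\Omega)=\{U' : U\in H^1(\Omega)\}\subseteq L^2(\Omega)$, and $$\mathcal H=L^2(\Omega)\times\nabla H^1(\Omega)\times L^2_\nu\big((0,\infty);L^2(\partial\Omega)\big),\qquad \|(p,v,\psi)\|^2=\|p\|_{L^2}^2+\|v\|_{L^2}^2+\int_{(0,\infty)}\|\psi(\tau)\|_{L^2(\partial\Omega)}^2\,d\nu(\tau).$$ Let $\mathcal A$ be the unbounded operator on $\mathcal H$ given by $\mathcal A(p,v,\psi)=(v',\,p',\,\tau\psi-\Gamma p)$, whose domain is the set of all $(p,v,\psi)\in\mathcal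 H$ such that $p$ and $v$ have weak derivatives in $L^2(\Omega)$, $\tau\mapsto\tau\psi(\tau)-\Gamma p$ belongs to $L^2_\nu((0,\infty);L^2(\partial\Omega))$, and $-v\cdot n+\int_{(0,\infty)}\psi(\tau)\,d\nu(\tau)=0$ on $\partial\Omega$. Here $v\cdot n\in L^2(\partial\Omega)$ is determined by $\sum_{x\in\partial\Omega}(v\cdot n)(x)\,\overline{\Gamma u(x)}=\int_\Omega v'\,\overline u+\int_\Omega v\,\overline{u'}$ for all $u\in H^1(\Omega)$. Then for every real $\sigma$ with $|\sigma|\ge1$ the operator $i\sigma+\mathcal A$ has a bounded inverse on $\mathcal H$. Moreover, there are constants $c,C>0$, which may depend on $k$, such that for all $s>1$ one has $\operatorname{Re}\hat k(is)>0$ and $$\frac{c}{\operatorname{Re}\hat k(is)}\ \le\ \sup_{1\le|\sigma|\le s}\big\|(i\sigma+\mathcal A)^{-1}\big\|\ \le\ \frac{C}{\operatorname{Re}\hat k(is)}.$$ -/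

import Mathlib

open MeasureTheory Set
open scoped NNReal ENNReal ContDiff

noncomputable section

namespace ViscoWave

/-! ### Sobolev notions on the interval `(0, 1)` -/

/-- Lebesgue measure on the domain `(0, 1)`. -/
abbrev volI : Measure ℝ := volume.restrict (Ioo 0 1)

/-- The complex space `L²(0, 1)`. -/
abbrev L2I : Type := Lp ℂ 2 volI

/-- The space `L²(∂Ω)` for `∂Ω = {0, 1}` with its surface (counting) measure. Coordinate `0` is the
value at the endpoint `0`, coordinate `1` is the value at the endpoint `1`. -/
abbrev L2Bdry : Type := EuclideanSpace ℂ (Fin 2)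

/-- `g ∈ L²(0, 1)` is the weak derivative of `u ∈ L²(0, 1)`. Thus `u ∈ H¹(0, 1)` means that
`HasWeakDeriv u g` for some `g`. Testing with real functions is enough, by linearity. -/
def HasWeakDeriv (u g : L2I) : Prop :=
  ∀ φ : ℝ → ℝ, ContDiff ℝ ∞ φ → HasCompactSupport φ → tsupport φ ⊆ Ioo 0 1 →
    ∫ x, deriv φ x • u x ∂volI = - ∫ x, φ x • g x ∂volI

/-- `γ ∈ L²(∂Ω)` is the trace of `u`: the boundary values of the representative of `u` that is
continuous on `[0, 1]`. Each `u ∈ H¹(0, 1)` has such a representative. -/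
def IsTrace (u : L2I) (γ : L2Bdry) : Prop :=
  ∃ w : ℝ → ℂ, ContinuousOn w (Icc 0 1) ∧ (u =ᵐ[volI] w) ∧ γ 0 = w 0 ∧ γ 1 = w 1

/-- `h` is the normal component `v · n` on the boundary of a field `v ∈ L²` with weak divergence
`dv ∈ L²`: for all `u ∈ H¹(0, 1)` with weak derivative `u'` and trace `γ`,
`∫ dv * conj u + ∫ v * conj u' = ∑_{x ∈ ∂Ω} h x * conj (γ x)`.
(The inner products here are conjugate linear in the first argument.) -/
def IsNormalTrace (v dv : L2I) (h : L2Bdry) : Prop :=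
  ∀ (u u' : L2I) (γ : L2Bdry), HasWeakDeriv u u' → IsTrace u γ →
    inner ℂ u dv + inner ℂ u' v = inner ℂ γ h

lemma integrable_smul_L2I (u : L2I) {ψ : ℝ → ℝ} (hc : Continuous ψ) (hs : HasCompactSupport ψ) :
    Integrable (fun x => ψ x • u x) volI := by
  have hu : Integrable u volI := (Lp.memLp u).integrable (by norm_num)
  obtain ⟨C, hC⟩ := hc.bounded_above_of_compact_support hs
  exact hu.bdd_smul C hc.aestronglyMeasurable (Filter.Eventually.of_forall hC)

lemma HasWeakDeriv.add {u g u' g' : L2I} (h : HasWeakDeriv u g) (h' : HasWeakDeriv u' g') :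
    HasWeakDeriv (u + u') (g + g') := by
  intro φ hφ hs ht
  have hd : Continuous (deriv φ) := hφ.continuous_deriv (by simp)
  have e1 : ∫ x, deriv φ x • (u + u') x ∂volI
      = ∫ x, (deriv φ x • u x + deriv φ x • u' x) ∂volI := by
    refine integral_congr_ae ?_
    filter_upwards [Lp.coeFn_add u u'] with x hx
    rw [hx, Pi.add_apply, smul_add]
  have e2 : ∫ x, φ x • (g + g') x ∂volI = ∫ x, (φ x • g x + φ x • g' x) ∂volI := by
    refine integral_congr_ae ?_
    filter_upwards [Lp.coeFn_add g g'] with x hx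
    rw [hx, Pi.add_apply, smul_add]
  rw [e1, e2, integral_add (integrable_smul_L2I u hd hs.deriv) (integrable_smul_L2I u' hd hs.deriv),
    integral_add (integrable_smul_L2I g hφ.continuous hs)
      (integrable_smul_L2I g' hφ.continuous hs), h φ hφ hs ht, h' φ hφ hs ht]
  ring

lemma HasWeakDeriv.smul {u g : L2I} (c : ℂ) (h : HasWeakDeriv u g) :
    HasWeakDeriv (c • u) (c • g) := by
  intro φ hφ hs ht
  have e1 : ∫ x, deriv φ x • (c • u) x ∂volI = ∫ x, c • (deriv φ x • u x) ∂volI := by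
    refine integral_congr_ae ?_
    filter_upwards [Lp.coeFn_smul c u] with x hx
    rw [hx, Pi.smul_apply, smul_comm]
  have e2 : ∫ x, φ x • (c • g) x ∂volI = ∫ x, c • (φ x • g x) ∂volI := by
    refine integral_congr_ae ?_
    filter_upwards [Lp.coeFn_smul c g] with x hx
    rw [hx, Pi.smul_apply, smul_comm]
  rw [e1, e2, integral_smul, integral_smul, h φ hφ hs ht, smul_neg]

lemma HasWeakDeriv.zero : HasWeakDeriv 0 0 := by
  have h : HasWeakDeriv (0 : L2I) 0 := by
    intro φ _ _ _
    have e : ∀ f : ℝ → ℝ, ∫ x, f x • (0 : L2I) x ∂volI = 0 := fun f => by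
      rw [← integral_zero (α := ℝ) (G := ℂ) (μ := volI)]
      refine integral_congr_ae ?_
      filter_upwards [Lp.coeFn_zero ℂ 2 volI] with x hx
      rw [hx, Pi.zero_apply, smul_zero]
    rw [e, e, neg_zero]
  exact h

lemma HasWeakDeriv.eq_zero {g : L2I} (h : HasWeakDeriv 0 g) : g = 0 := by
  have hg : Integrable g volI := (Lp.memLp g).integrable (by norm_num)
  have key : ∀ᵐ x ∂(volume : Measure ℝ), x ∈ Ioo (0 : ℝ) 1 → g x = 0 := by
    refine isOpen_Ioo.ae_eq_zero_of_integral_contDiff_smul_eq_zero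
      (IntegrableOn.locallyIntegrableOn hg) ?_
    intro φ hφ hs ht
    have e : ∫ x, deriv φ x • (0 : L2I) x ∂volI = 0 := by
      rw [← integral_zero (α := ℝ) (G := ℂ) (μ := volI)]
      refine integral_congr_ae ?_
      filter_upwards [Lp.coeFn_zero ℂ 2 volI] with x hx
      rw [hx, Pi.zero_apply, smul_zero]
    have h1 := h φ hφ hs ht
    rw [e, eq_comm, neg_eq_zero] at h1
    rw [← h1]
    refine (setIntegral_eq_integral_of_forall_compl_eq_zero fun x hx => ?_).symm
    rw [image_eq_zero_of_notMem_tsupport fun hx' => hx (ht hx'), zero_smul]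
  refine Lp.eq_zero_iff_ae_eq_zero.mpr ?_
  exact (ae_restrict_iff' measurableSet_Ioo).mpr key

lemma IsTrace.add {u u' : L2I} {γ γ' : L2Bdry} (h : IsTrace u γ) (h' : IsTrace u' γ') :
    IsTrace (u + u') (γ + γ') := by
  obtain ⟨w, hw, hu, h0, h1⟩ := h
  obtain ⟨w', hw', hu', h0', h1'⟩ := h'
  refine ⟨w + w', hw.add hw', (Lp.coeFn_add u u').trans (hu.add hu'), ?_, ?_⟩ <;> simp [*]

lemma IsTrace.smul {u : L2I} {γ : L2Bdry} (c : ℂ) (h : IsTrace u γ) :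
    IsTrace (c • u) (c • γ) := by
  obtain ⟨w, hw, hu, h0, h1⟩ := h
  refine ⟨c • w, hw.const_smul c, (Lp.coeFn_smul c u).trans (hu.const_smul c), ?_, ?_⟩ <;> simp [*]

lemma IsTrace.zero : IsTrace 0 0 :=
  ⟨0, continuousOn_const, Lp.coeFn_zero ℂ 2 volI, rfl, rfl⟩

lemma IsTrace.eq_zero {γ : L2Bdry} (h : IsTrace 0 γ) : γ = 0 := by
  obtain ⟨w, hw, hu, h0, h1⟩ := h
  have h2 : (0 : ℝ → ℂ) =ᵐ[volI] w := (Lp.coeFn_zero ℂ 2 volI).symm.trans hu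
  have h3 : EqOn (0 : ℝ → ℂ) w (Icc 0 1) := by
    have h4 : EqOn (0 : ℝ → ℂ) w (Ioo 0 1) :=
      Measure.eqOn_open_of_ae_eq h2 isOpen_Ioo continuousOn_const (hw.mono Ioo_subset_Icc_self)
    have h5 := h4.of_subset_closure (t := Icc (0 : ℝ) 1) continuousOn_const hw Ioo_subset_Icc_self
      (by rw [closure_Ioo zero_ne_one])
    exact h5
  ext j
  fin_cases j
  · simpa [h0] using (h3 (left_mem_Icc.mpr zero_le_one)).symm
  · simpa [h1] using (h3 (right_mem_Icc.mpr zero_le_one)).symm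

lemma IsNormalTrace.add {v dv v' dv' : L2I} {h h' : L2Bdry} (H : IsNormalTrace v dv h)
    (H' : IsNormalTrace v' dv' h') : IsNormalTrace (v + v') (dv + dv') (h + h') := by
  intro u u' γ hu hγ
  rw [inner_add_right, inner_add_right, inner_add_right, ← H u u' γ hu hγ, ← H' u u' γ hu hγ]
  ring

lemma IsNormalTrace.smul {v dv : L2I} {h : L2Bdry} (c : ℂ) (H : IsNormalTrace v dv h) :
    IsNormalTrace (c • v) (c • dv) (c • h) := by
  intro u u' γ hu hγ
  rw [inner_smul_right, inner_smul_right, inner_smul_right, ← H u u' γ hu hγ]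
  ring

lemma IsNormalTrace.zero : IsNormalTrace 0 0 0 := by
  intro u u' γ _ _
  simp

/-- The space `∇H¹(0, 1)` of gradient fields, as a subspace of `L²(0, 1)`. -/
def gradSpace : Submodule ℂ L2I where
  carrier := {v | ∃ U, HasWeakDeriv U v}
  add_mem' := by
    rintro _ _ ⟨U, hU⟩ ⟨V, hV⟩
    exact ⟨U + V, hU.add hV⟩
  zero_mem' := ⟨0, HasWeakDeriv.zero⟩
  smul_mem' := by
    rintro c _ ⟨U, hU⟩
    exact ⟨c • U, hU.smul c⟩

/-! ### State space and wave operator for a measure `ν` on `[0, ∞)` -/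

/-- The memory space `L²_ν((0, ∞); L²(∂Ω))`. -/
abbrev L2Memory (ν : Measure ℝ≥0) : Type := Lp L2Bdry 2 (ν.restrict (Ioi 0))

/-- The energy space `L²(Ω) × ∇H¹(Ω) × L²_ν((0, ∞); L²(∂Ω))` for `Ω = (0, 1)`, with the norm
`‖(p, v, ψ)‖² = ‖p‖² + ‖v‖² + ‖ψ‖²`. -/
abbrev StateSpace (ν : Measure ℝ≥0) : Type :=
  WithLp 2 (L2I × WithLp 2 (gradSpace × L2Memory ν))

variable {ν : Measure ℝ≥0}

/-- The pressure component `p` of a state `(p, v, ψ)`. -/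
def pressure (x : StateSpace ν) : L2I := x.fst

/-- The velocity component `v` of a state `(p, v, ψ)`. -/
def velocity (x : StateSpace ν) : L2I := x.snd.fst

/-- The memory component `ψ` of a state `(p, v, ψ)`. -/
def memory (x : StateSpace ν) : L2Memory ν := x.snd.snd

lemma pressure_add (x y : StateSpace ν) : pressure (x + y) = pressure x + pressure y := rfl
lemma velocity_add (x y : StateSpace ν) : velocity (x + y) = velocity x + velocity y := rfl
lemma memory_add (x y : StateSpace ν) : memory (x + y) = memory x + memory y := rfl
lemma pressure_smul (c : ℂ) (x : StateSpace ν) : pressure (c • x) = c • pressure x := rfl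
lemma velocity_smul (c : ℂ) (x : StateSpace ν) : velocity (c • x) = c • velocity x := rfl
lemma memory_smul (c : ℂ) (x : StateSpace ν) : memory (c • x) = c • memory x := rfl

/-- `y = 𝒜 x`, for `x = (p, v, ψ)` in the domain of `𝒜`: `p` and `v` have weak derivatives in `L²`,
`y = (v', p', τ ψ - Γ p)`, with the last component in `L²_ν`, and the boundary condition
`-v · n + ∫ ψ dν = 0` holds. -/
structure IsWaveImage (x y : StateSpace ν) : Prop where
  div_velocity : HasWeakDeriv (velocity x) (pressure y)
  grad_pressure : HasWeakDeriv (pressure x) (velocity y)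
  memory_eq : ∃ γ : L2Bdry, IsTrace (pressure x) γ ∧
    ∀ᵐ τ ∂(ν.restrict (Ioi 0)), memory y τ = ((τ : ℝ) : ℂ) • memory x τ - γ
  memory_integrable : Integrable (memory x) (ν.restrict (Ioi 0))
  boundary : IsNormalTrace (velocity x) (pressure y) (∫ τ, memory x τ ∂(ν.restrict (Ioi 0)))

lemma IsWaveImage.add {x y x' y' : StateSpace ν} (h : IsWaveImage x y) (h' : IsWaveImage x' y') :
    IsWaveImage (x + x') (y + y') where
  div_velocity := h.div_velocity.add h'.div_velocity
  grad_pressure := h.grad_pressure.add h'.grad_pressure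
  memory_eq := by
    obtain ⟨γ, hγ, he⟩ := h.memory_eq
    obtain ⟨γ', hγ', he'⟩ := h'.memory_eq
    refine ⟨γ + γ', hγ.add hγ', ?_⟩
    rw [memory_add, memory_add]
    filter_upwards [he, he', Lp.coeFn_add (memory x) (memory x'),
      Lp.coeFn_add (memory y) (memory y')] with τ h1 h2 h3 h4
    rw [h3, h4, Pi.add_apply, Pi.add_apply, h1, h2, smul_add]
    abel
  memory_integrable := by
    rw [memory_add]
    exact (h.memory_integrable.add h'.memory_integrable).congr (Lp.coeFn_add _ _).symm
  boundary := by
    have e : ∫ τ, memory (x + x') τ ∂(ν.restrict (Ioi 0))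
        = ∫ τ, memory x τ ∂(ν.restrict (Ioi 0)) + ∫ τ, memory x' τ ∂(ν.restrict (Ioi 0)) := by
      rw [memory_add, ← integral_add h.memory_integrable h'.memory_integrable]
      exact integral_congr_ae (Lp.coeFn_add _ _)
    rw [e]
    exact h.boundary.add h'.boundary

lemma IsWaveImage.smul {x y : StateSpace ν} (c : ℂ) (h : IsWaveImage x y) :
    IsWaveImage (c • x) (c • y) where
  div_velocity := h.div_velocity.smul c
  grad_pressure := h.grad_pressure.smul c
  memory_eq := by
    obtain ⟨γ, hγ, he⟩ := h.memory_eq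
    refine ⟨c • γ, hγ.smul c, ?_⟩
    rw [memory_smul, memory_smul]
    filter_upwards [he, Lp.coeFn_smul c (memory x), Lp.coeFn_smul c (memory y)] with τ h1 h3 h4
    rw [h3, h4, Pi.smul_apply, Pi.smul_apply, h1, smul_sub, smul_comm]
  memory_integrable := by
    rw [memory_smul]
    exact (h.memory_integrable.smul c).congr (Lp.coeFn_smul _ _).symm
  boundary := by
    have e : ∫ τ, memory (c • x) τ ∂(ν.restrict (Ioi 0))
        = c • ∫ τ, memory x τ ∂(ν.restrict (Ioi 0)) := by
      rw [memory_smul, ← integral_smul]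
      exact integral_congr_ae (Lp.coeFn_smul _ _)
    rw [e]
    exact h.boundary.smul c

lemma IsWaveImage.zero : IsWaveImage (0 : StateSpace ν) 0 where
  div_velocity := HasWeakDeriv.zero
  grad_pressure := HasWeakDeriv.zero
  memory_eq := by
    refine ⟨0, IsTrace.zero, ?_⟩
    have e : memory (0 : StateSpace ν) = 0 := rfl
    rw [e]
    filter_upwards [Lp.coeFn_zero L2Bdry 2 (ν.restrict (Ioi 0))] with τ h
    rw [h, Pi.zero_apply, smul_zero, sub_zero]
  memory_integrable := by
    have e : memory (0 : StateSpace ν) = 0 := rfl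
    rw [e]
    exact (integrable_zero _ _ _).congr (Lp.coeFn_zero L2Bdry 2 (ν.restrict (Ioi 0))).symm
  boundary := by
    have e : ∫ τ, memory (0 : StateSpace ν) τ ∂(ν.restrict (Ioi 0)) = 0 := by
      have e : memory (0 : StateSpace ν) = 0 := rfl
      rw [e, integral_congr_ae (Lp.coeFn_zero L2Bdry 2 (ν.restrict (Ioi 0)))]
      simp
    rw [e]
    exact IsNormalTrace.zero

variable (ν) in
/-- The graph of the wave operator. -/
def waveGraph : Submodule ℂ (StateSpace ν × StateSpace ν) where
  carrier := {z | IsWaveImage z.1 z.2}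
  add_mem' h h' := h.add h'
  zero_mem' := IsWaveImage.zero
  smul_mem' c _ h := h.smul c

variable (ν) in
/-- The wave operator `𝒜 (p, v, ψ) = (div v, ∇ p, τ ψ - Γ p)` as an unbounded operator. -/
def waveOp : StateSpace ν →ₗ.[ℂ] StateSpace ν := (waveGraph ν).toLinearPMap

/-- The relation defining the wave operator is single valued, so it is the graph of `waveOp`. -/
lemma waveOp_graph : (waveOp ν).graph = waveGraph ν := by
  refine Submodule.toLinearPMap_graph_eq _ ?_
  rintro ⟨x, y⟩ hz hx
  obtain rfl : x = 0 := hx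
  have h : IsWaveImage (0 : StateSpace ν) y := hz
  have h1 : pressure y = 0 := HasWeakDeriv.eq_zero h.div_velocity
  have h2 : velocity y = 0 := HasWeakDeriv.eq_zero h.grad_pressure
  have h3 : memory y = 0 := by
    obtain ⟨γ, hγ, he⟩ := h.memory_eq
    obtain rfl : γ = 0 := IsTrace.eq_zero hγ
    have e : memory (0 : StateSpace ν) = 0 := rfl
    rw [e] at he
    refine Lp.eq_zero_iff_ae_eq_zero.mpr ?_
    filter_upwards [he, Lp.coeFn_zero L2Bdry 2 (ν.restrict (Ioi 0))] with τ h4 h5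
    rw [h4, h5, Pi.zero_apply, smul_zero, sub_zero]
  have h2' : y.snd.fst = 0 := Subtype.ext h2
  have e1 : y.snd = 0 := (WithLp.ofLp_injective 2) (Prod.ext h2' h3)
  exact (WithLp.ofLp_injective 2) (Prod.ext h1 e1)

/-- The bounded operator `B` is the inverse `(z + A)⁻¹` of the unbounded operator `z + A`. -/
def IsInverseShift {E : Type*} [NormedAddCommGroup E] [NormedSpace ℂ E] (A : E →ₗ.[ℂ] E) (z : ℂ)
    (B : E →L[ℂ] E) : Prop :=
  (∀ x : A.domain, B (z • (x : E) + A x) = x) ∧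
    ∀ y : E, ∃ h : B y ∈ A.domain, z • B y + A ⟨B y, h⟩ = y

/-! ### Completely monotonic kernels -/

/-- `k` is completely monotonic with representing measure `ν` on `[0, ∞)`:
`k t = ∫ exp (-τ t) dν(τ)` for `t > 0`. -/
def IsCompletelyMonotonicWith (k : ℝ → ℝ) (ν : Measure ℝ≥0) : Prop :=
  ∀ t : ℝ, 0 < t → Integrable (fun τ : ℝ≥0 => Real.exp (-(τ * t))) ν ∧
    k t = ∫ τ : ℝ≥0, Real.exp (-(τ * t)) ∂ν

/-- The Laplace transform of `k`. -/
def laplace (k : ℝ → ℝ) (z : ℂ) : ℂ := ∫ t in Ioi (0 : ℝ), Complex.exp (-z * t) * (k t : ℂ)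

end ViscoWave

end

/-! Since `k` is integrable, Tonelli shows that `ν` has no mass at 0 and that `∫ τ⁻¹ dν = ∫ k < ∞`;
Fubini then gives `k̂(iσ) = κ(σ) := ∫ dν(τ) / (τ + iσ)`. This impedance is bounded, tends to 0 at
infinity, and has the positive real part `∫ τ / (τ² + σ²) dν`, which decreases in `|σ|`.

Upper bound. In `(iσ + 𝒜)x = y` the memory equation is solved by division, `ψ = (h + Γp) / (τ +
iσ)`, where `h` is the memory component of `y`. The boundary condition becomes `v·n = κ Γp + H` with
`H = ∫ h / (τ + iσ) dν`. The waves `p ± v` solve decoupled transport equations, so everything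
reduces to a 2×2 system for their values at 0. Its determinant has modulus at least `|1 + κ|² - |1 -
κ|² = 4 Re κ`. This gives solvability (`exists_resolvent_solution`) and the estimate `C / Re κ(σ)`
(`exists_resolvent_bound`); monotonicity of `Re κ` turns it into a bound on the supremum.

Lower bound. With `κ(σ)` frozen, the homogeneous problem has a mode at complex frequency `μ` when
`exp(-iμ) = (1 + κ) / (1 - κ)`. That mode solves the equation at `σ` up to an error `|σ - μ|`
(`exists_quasimode`). The intermediate value theorem finds, in every window of fixed length far
enough out, a real `σ` equal to the real part of such a `μ`. Then `|σ - μ|` is the logarithm of a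
reflection modulus, hence `O(Re κ(σ))`, and `Re κ(σ)` is comparable with `Re κ(s)` across the
window. For `s` in a bounded range, `‖R 1‖ > 0` suffices. -/

noncomputable section
namespace ViscoWave

/-! ### Absolutely continuous functions on the unit interval -/

/-- `U` is absolutely continuous on `[0, 1]` with almost everywhere derivative `f`. -/
structure IsPrimitive (U f : ℝ → ℂ) : Prop where
  intervalIntegrable : IntervalIntegrable f volume 0 1
  eq_integral : ∀ x ∈ Icc (0 : ℝ) 1, U x = U 0 + ∫ t in (0 : ℝ)..x, f t

lemma uIcc_zero_one : uIcc (0 : ℝ) 1 = Icc 0 1 := uIcc_of_le zero_le_one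

lemma intervalIntegrable_iff_volI {f : ℝ → ℂ} :
    IntervalIntegrable f volume 0 1 ↔ Integrable f volI := by
  rw [intervalIntegrable_iff_integrableOn_Ioo_of_le zero_le_one]; rfl

lemma intervalIntegral_eq_volI (f : ℝ → ℂ) : ∫ t in (0 : ℝ)..1, f t = ∫ t, f t ∂volI := by
  rw [intervalIntegral.integral_of_le zero_le_one, integral_Ioc_eq_integral_Ioo]

/-- The increments of the primitive of `f` are dominated by those of the primitive of `‖f‖`, which
is real-valued and absolutely continuous. -/
lemma absolutelyContinuous_integral {f : ℝ → ℂ} (h : IntervalIntegrable f volume 0 1) :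
    AbsolutelyContinuousOnInterval (fun x => ∫ t in (0 : ℝ)..x, f t) 0 1 := by
  have hG := h.norm.absolutelyContinuousOnInterval_intervalIntegral (c := 0) left_mem_uIcc
  have hsub : ∀ x ∈ uIcc (0 : ℝ) 1, IntervalIntegrable f volume 0 x := fun x hx =>
    h.mono_set (uIcc_subset_uIcc left_mem_uIcc hx)
  refine squeeze_zero' (Filter.Eventually.of_forall fun _ =>
    Finset.sum_nonneg fun _ _ => dist_nonneg) ?_ hG
  rw [Filter.eventually_inf_principal]
  refine Filter.Eventually.of_forall fun E hE => Finset.sum_le_sum fun i hi => ?_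
  have h1 := hsub _ (hE.1 i hi).1
  have h2 := hsub _ (hE.1 i hi).2
  rw [dist_comm, dist_comm (∫ t in (0 : ℝ)..(E.2 i).1, ‖f t‖), dist_eq_norm, dist_eq_norm,
    intervalIntegral.integral_interval_sub_left h2 h1,
    intervalIntegral.integral_interval_sub_left h2.norm h1.norm]
  exact intervalIntegral.norm_integral_le_abs_integral_norm

namespace IsPrimitive

variable {U V f g : ℝ → ℂ}

lemma absolutelyContinuous_aux (hU : IsPrimitive U f) :
    AbsolutelyContinuousOnInterval (fun x => U 0 + ∫ t in (0 : ℝ)..x, f t) 0 1 := by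
  have := absolutelyContinuous_integral hU.intervalIntegrable
  simpa [AbsolutelyContinuousOnInterval] using this

lemma absolutelyContinuous (hU : IsPrimitive U f) : AbsolutelyContinuousOnInterval U 0 1 := by
  refine squeeze_zero' (Filter.Eventually.of_forall fun _ =>
    Finset.sum_nonneg fun _ _ => dist_nonneg) ?_ hU.absolutelyContinuous_aux
  rw [Filter.eventually_inf_principal]
  refine Filter.Eventually.of_forall fun E hE => Finset.sum_le_sum fun i hi => ?_
  exact (congrArg₂ dist (hU.eq_integral _ (uIcc_zero_one ▸ (hE.1 i hi).1))
    (hU.eq_integral _ (uIcc_zero_one ▸ (hE.1 i hi).2))).le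

lemma continuousOn (hU : IsPrimitive U f) : ContinuousOn U (Icc 0 1) :=
  uIcc_zero_one ▸ hU.absolutelyContinuous.continuousOn

lemma ae_hasDerivAt (hU : IsPrimitive U f) :
    ∀ᵐ x, x ∈ Ioo (0 : ℝ) 1 → HasDerivAt U (f x) x := by
  filter_upwards [hU.intervalIntegrable.ae_hasDerivAt_integral] with x hx hx'
  have h := (hx (uIcc_zero_one ▸ Ioo_subset_Icc_self hx') 0 left_mem_uIcc).const_add (U 0)
  refine h.congr_of_eventuallyEq ?_
  filter_upwards [isOpen_Ioo.mem_nhds hx'] with y hy using hU.eq_integral y (Ioo_subset_Icc_self hy)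

/-- The difference of `U` and the integral of `f` is absolutely continuous with derivative zero
almost everywhere, hence constant. The sum and product rules follow from this criterion. -/
lemma of_absolutelyContinuous (hU : AbsolutelyContinuousOnInterval U 0 1)
    (hf : IntervalIntegrable f volume 0 1)
    (hd : ∀ᵐ x, x ∈ Ioo (0 : ℝ) 1 → HasDerivAt U (f x) x) : IsPrimitive U f := by
  refine ⟨hf, ?_⟩
  have hF : IsPrimitive (fun x => ∫ t in (0 : ℝ)..x, f t) f := ⟨hf, fun x _ => by simp⟩
  have hne : ∀ y : ℝ, ∀ᵐ x, x ≠ y := fun y => by simp [ae_iff, measure_singleton]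
  obtain ⟨C, hC⟩ := (hU.sub hF.absolutelyContinuous).const_of_ae_hasDerivAt_zero (by
    filter_upwards [hd, hF.ae_hasDerivAt, hne 0, hne 1] with x h1 h2 h3 h4 h5
    rw [uIcc_zero_one] at h5
    have h6 : x ∈ Ioo (0 : ℝ) 1 := ⟨lt_of_le_of_ne h5.1 h3.symm, lt_of_le_of_ne h5.2 h4⟩
    simpa using (h1 h6).sub (h2 h6))
  intro x hx
  have h0 := hC 0 left_mem_uIcc
  have h1 := hC x (uIcc_zero_one ▸ hx)
  simp only [Pi.sub_apply, intervalIntegral.integral_same, sub_zero] at h0 h1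
  rw [h0, ← h1, sub_add_cancel]

lemma integrable (hU : IsPrimitive U f) : Integrable f volI :=
  intervalIntegrable_iff_volI.1 hU.intervalIntegrable

lemma congr_ae (hU : IsPrimitive U f) (h : f =ᵐ[volI] g) : IsPrimitive U g := by
  refine of_absolutelyContinuous hU.absolutelyContinuous
    (intervalIntegrable_iff_volI.2 (hU.integrable.congr h)) ?_
  filter_upwards [hU.ae_hasDerivAt, (ae_restrict_iff' measurableSet_Ioo).1 h] with x h1 h2 h3
  exact h2 h3 ▸ h1 h3

lemma of_hasDerivAt (h : ∀ x, HasDerivAt U (f x) x) (hf : Continuous f) : IsPrimitive U f := by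
  refine ⟨hf.intervalIntegrable _ _, fun x _ => ?_⟩
  rw [intervalIntegral.integral_eq_sub_of_hasDerivAt (fun y _ => h y) (hf.intervalIntegrable _ _)]
  ring

lemma add (hU : IsPrimitive U f) (hV : IsPrimitive V g) : IsPrimitive (U + V) (f + g) := by
  refine of_absolutelyContinuous (hU.absolutelyContinuous.add hV.absolutelyContinuous)
    (hU.intervalIntegrable.add hV.intervalIntegrable) ?_
  filter_upwards [hU.ae_hasDerivAt, hV.ae_hasDerivAt] with x h1 h2 h3 using (h1 h3).add (h2 h3)

lemma mul (hU : IsPrimitive U f) (hV : IsPrimitive V g) :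
    IsPrimitive (U * V) (f * V + U * g) := by
  refine of_absolutelyContinuous (hU.absolutelyContinuous.smul hV.absolutelyContinuous) ?_ ?_
  · exact (hU.intervalIntegrable.mul_continuousOn hV.absolutelyContinuous.continuousOn).add
      (hV.intervalIntegrable.continuousOn_mul hU.absolutelyContinuous.continuousOn)
  · filter_upwards [hU.ae_hasDerivAt, hV.ae_hasDerivAt] with x h1 h2 h3 using (h1 h3).mul (h2 h3)

lemma const_smul (c : ℂ) (hU : IsPrimitive U f) : IsPrimitive (c • U) (c • f) := by
  refine ⟨hU.intervalIntegrable.smul c, fun x hx => ?_⟩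
  simp only [Pi.smul_apply, intervalIntegral.integral_smul, ← smul_add]
  rw [hU.eq_integral x hx]

lemma star (hU : IsPrimitive U f) :
    IsPrimitive (fun x => starRingEnd ℂ (U x)) (fun x => starRingEnd ℂ (f x)) := by
  refine ⟨?_, fun x hx => ?_⟩
  · have := hU.intervalIntegrable
    rw [intervalIntegrable_iff] at this ⊢
    exact (Complex.conjCLE.toContinuousLinearMap.integrable_comp this)
  · rw [hU.eq_integral x hx, map_add]
    congr 1
    simp only [intervalIntegral.integral_of_le hx.1]
    exact integral_conj.symm

lemma integral_eq_sub (hU : IsPrimitive U f) : ∫ t, f t ∂volI = U 1 - U 0 := by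
  rw [← intervalIntegral_eq_volI, hU.eq_integral 1 (by simp)]
  ring

lemma sub (hU : IsPrimitive U f) (hV : IsPrimitive V g) : IsPrimitive (U - V) (f - g) := by
  simpa [sub_eq_add_neg] using hU.add (hV.const_smul (-1))

end IsPrimitive

/-! ### Weak derivatives, traces and normal traces through continuous representatives -/

lemma L2I_integrable (u : L2I) : Integrable u volI := (Lp.memLp u).integrable (by norm_num)

lemma isPrimitive_integral (g : L2I) : IsPrimitive (fun x => ∫ t in (0 : ℝ)..x, g t) g :=
  ⟨intervalIntegrable_iff_volI.2 (L2I_integrable g), fun x _ => by simp⟩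

lemma memLp_of_continuousOn {U : ℝ → ℂ} (hU : ContinuousOn U (Icc 0 1)) : MemLp U 2 volI := by
  obtain ⟨C, hC⟩ := isCompact_Icc.exists_bound_of_continuousOn hU
  refine MemLp.of_bound ((hU.mono Ioo_subset_Icc_self).aestronglyMeasurable measurableSet_Ioo) C ?_
  exact (ae_restrict_iff' measurableSet_Ioo).2
    (Filter.Eventually.of_forall fun x hx => hC x (Ioo_subset_Icc_self hx))

/-- Integrate the product rule for `φ * U`; the boundary terms vanish because `φ` is zero at both
endpoints. -/
lemma HasWeakDeriv.of_isPrimitive {u g : L2I} {U : ℝ → ℂ} (hU : IsPrimitive U g)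
    (hu : u =ᵐ[volI] U) : HasWeakDeriv u g := by
  intro φ hφ hs ht
  have hφ' : IsPrimitive (fun x => (φ x : ℂ)) (fun x => Complex.ofReal (deriv φ x)) := by
    refine IsPrimitive.of_hasDerivAt (fun x => ?_) ?_
    · exact ((hφ.differentiable (by simp)).differentiableAt.hasDerivAt).ofReal_comp
    · exact Complex.continuous_ofReal.comp (hφ.continuous_deriv (by simp))
  have h0 : ∀ x, x ∉ Ioo (0 : ℝ) 1 → φ x = 0 := fun x hx =>
    image_eq_zero_of_notMem_tsupport fun h => hx (ht h)
  have h := (hφ'.mul hU).integral_eq_sub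
  simp only [Pi.mul_apply, Pi.add_apply, h0 0 (by simp), h0 1 (by simp), Complex.ofReal_zero,
    zero_mul, sub_zero] at h
  rw [eq_neg_iff_add_eq_zero, ← h, ← integral_add
    (integrable_smul_L2I u (hφ.continuous_deriv (by simp)) hs.deriv)
    (integrable_smul_L2I g hφ.continuous hs)]
  refine integral_congr_ae ?_
  filter_upwards [hu] with x hx
  simp [hx]

/-- The primitive vanishes to the left of the support of `φ` trivially, and to its right because `φ`
has mean zero. -/
lemma exists_smooth_primitive {φ : ℝ → ℝ} (hφ : ContDiff ℝ ∞ φ) (hs : HasCompactSupport φ)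
    (ht : tsupport φ ⊆ Ioo 0 1) (h0 : ∫ x, φ x = 0) :
    ∃ Φ : ℝ → ℝ, ContDiff ℝ ∞ Φ ∧ HasCompactSupport Φ ∧ tsupport Φ ⊆ Ioo 0 1 ∧ deriv Φ = φ := by
  have hd : ∀ x, HasDerivAt (fun x => ∫ t in (0 : ℝ)..x, φ t) (φ x) x := fun x =>
    (hφ.continuous.integral_hasStrictDerivAt 0 x).hasDerivAt
  have hd' : deriv (fun x => ∫ t in (0 : ℝ)..x, φ t) = φ := funext fun x => (hd x).deriv
  have hz : ∀ x, x ∉ tsupport φ → φ x = 0 := fun x hx => image_eq_zero_of_notMem_tsupport hx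
  obtain ⟨a, b, ha, hb, hab⟩ : ∃ a b : ℝ, 0 < a ∧ b < 1 ∧ tsupport φ ⊆ Icc a b := by
    rcases (tsupport φ).eq_empty_or_nonempty with he | hne
    · exact ⟨1, 0, one_pos, one_pos, by simp [he]⟩
    · have hc : IsCompact (tsupport φ) := hs
      exact ⟨_, _, (ht (hc.sInf_mem hne)).1, (ht (hc.sSup_mem hne)).2, fun x hx =>
        ⟨csInf_le hc.bddBelow hx, le_csSup hc.bddAbove hx⟩⟩
  have hsub : Function.support (fun x => ∫ t in (0 : ℝ)..x, φ t) ⊆ Icc a b := by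
    intro x hx
    by_contra hx'
    refine hx ?_
    rcases lt_or_ge x a with h | h
    · refine intervalIntegral.integral_zero_ae (Filter.Eventually.of_forall fun t ht' => ?_)
      refine hz t fun h1 => ?_
      have h2 := (hab h1).1
      have h3 := ht'.2
      rcases max_cases (0 : ℝ) x with ⟨h4, _⟩ | ⟨h4, _⟩ <;> linarith
    · have hxb : b < x := by
        by_contra h1
        exact hx' ⟨h, not_lt.1 h1⟩
      change ∫ t in (0 : ℝ)..x, φ t = 0
      rw [intervalIntegral.integral_of_le (ha.le.trans h),
        setIntegral_eq_integral_of_forall_compl_eq_zero, h0]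
      intro t ht'
      refine hz t fun h1 => ht' ⟨ha.trans_le (hab h1).1, (hab h1).2.trans hxb.le⟩
  refine ⟨fun x => ∫ t in (0 : ℝ)..x, φ t, ?_, ?_, ?_, hd'⟩
  · rw [contDiff_infty_iff_deriv, hd']
    exact ⟨fun x => (hd x).differentiableAt, hφ⟩
  · exact HasCompactSupport.of_support_subset_isCompact isCompact_Icc hsub
  · exact (closure_minimal hsub isClosed_Icc).trans fun x hx =>
      ⟨ha.trans_le hx.1, hx.2.trans_lt hb⟩

/-- The du Bois-Reymond argument: for a bump `η` of integral one, `φ - (∫ φ) η` has mean zero, so it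
is the derivative of a test function and is annihilated by `w`. Hence `w - ∫ η w` is annihilated by
every `φ`. -/
lemma HasWeakDeriv.eq_const {w : L2I} (h : HasWeakDeriv w 0) :
    ∃ c : ℂ, w =ᵐ[volI] fun _ => c := by
  let b : ContDiffBump (1 / 2 : ℝ) := ⟨1 / 8, 1 / 4, by norm_num, by norm_num⟩
  let η : ℝ → ℝ := b.normed volume
  have hη : ContDiff ℝ ∞ η := b.contDiff_normed
  have hηs : HasCompactSupport η := b.hasCompactSupport_normed
  have hη1 : ∫ x, η x = 1 := b.integral_normed
  have hηt : tsupport η ⊆ Ioo 0 1 := by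
    rw [b.tsupport_normed_eq, Real.closedBall_eq_Icc]
    intro x hx
    change x ∈ Icc ((1 / 2 : ℝ) - 1 / 4) (1 / 2 + 1 / 4) at hx
    constructor <;> linarith [hx.1, hx.2]
  have hw := L2I_integrable w
  refine ⟨∫ x, η x • w x ∂volI, ?_⟩
  set c := ∫ x, η x • w x ∂volI
  have key : ∀ᵐ x ∂(volume : Measure ℝ), x ∈ Ioo (0 : ℝ) 1 → w x - c = 0 := by
    refine isOpen_Ioo.ae_eq_zero_of_integral_contDiff_smul_eq_zero
      (IntegrableOn.locallyIntegrableOn (hw.sub (integrable_const c))) ?_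
    intro φ hφ hs ht
    have hz : ∀ x, x ∉ Ioo (0 : ℝ) 1 → φ x = 0 := fun x hx =>
      image_eq_zero_of_notMem_tsupport fun h => hx (ht h)
    have hφi : Integrable φ := hφ.continuous.integrable_of_hasCompactSupport hs
    have hηi : Integrable η := hη.continuous.integrable_of_hasCompactSupport hηs
    obtain ⟨Φ, hΦ, hΦs, hΦt, hΦd⟩ := exists_smooth_primitive
      (φ := fun x => φ x - (∫ y, φ y) * η x) (hφ.sub (contDiff_const.mul hη))
      (hs.sub (hηs.mul_left)) (by
        refine (tsupport_sub _ _).trans (union_subset ht ?_)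
        exact (tsupport_mul_subset_right).trans hηt) (by
        rw [integral_sub hφi (hηi.const_mul _), integral_const_mul, hη1, mul_one, sub_self])
    have h1 := h Φ hΦ hΦs hΦt
    have h2 : ∫ x, Φ x • (0 : L2I) x ∂volI = 0 := by
      rw [← integral_zero (α := ℝ) (G := ℂ) (μ := volI)]
      refine integral_congr_ae ?_
      filter_upwards [Lp.coeFn_zero ℂ 2 volI] with x hx
      rw [hx, Pi.zero_apply, smul_zero]
    have h3 : ∫ x, deriv Φ x • w x ∂volI
        = ∫ x, φ x • w x ∂volI - (∫ y, φ y) • c := by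
      rw [← integral_smul]
      refine Eq.trans ?_ (integral_sub (integrable_smul_L2I w hφ.continuous hs)
        ((integrable_smul_L2I w hη.continuous hηs).smul (∫ y, φ y)))
      refine integral_congr_ae (Filter.Eventually.of_forall fun x => ?_)
      simp only [hΦd, sub_smul, mul_smul]
    rw [h2, neg_zero, h3, sub_eq_zero] at h1
    rw [← setIntegral_eq_integral_of_forall_compl_eq_zero (s := Ioo 0 1)
      fun x hx => by rw [hz x hx, zero_smul]]
    simp_rw [smul_sub]
    rw [integral_sub (integrable_smul_L2I w hφ.continuous hs)
      ((hφi.mono_measure Measure.restrict_le_self).smul_const c), h1, integral_smul_const,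
      setIntegral_eq_integral_of_forall_compl_eq_zero hz, sub_self]
  filter_upwards [(ae_restrict_iff' measurableSet_Ioo).mpr key] with x hx using sub_eq_zero.1 hx

/-- A weakly differentiable function has an absolutely continuous representative. -/
lemma HasWeakDeriv.exists_isPrimitive {u g : L2I} (h : HasWeakDeriv u g) :
    ∃ U, IsPrimitive U g ∧ u =ᵐ[volI] U := by
  have hG := isPrimitive_integral g
  set G : ℝ → ℂ := fun x => ∫ t in (0 : ℝ)..x, g t
  have hGm : MemLp G 2 volI := memLp_of_continuousOn hG.continuousOn
  have hW : HasWeakDeriv (hGm.toLp G) g := HasWeakDeriv.of_isPrimitive hG hGm.coeFn_toLp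
  have h1 := h.add (hW.smul (-1))
  simp only [neg_smul, one_smul, add_neg_cancel] at h1
  obtain ⟨c, hc⟩ := h1.eq_const
  refine ⟨(fun _ => c) + G, ⟨hG.intervalIntegrable, fun x hx => ?_⟩, ?_⟩
  · simp [G]
  · filter_upwards [hc, Lp.coeFn_add u (-hGm.toLp G), Lp.coeFn_neg (hGm.toLp G), hGm.coeFn_toLp]
      with x h1 h2 h3 h4
    rw [Pi.add_apply, ← h1, h2, Pi.add_apply, h3, Pi.neg_apply, h4, neg_add_cancel_right]

lemma IsTrace.unique {u : L2I} {γ γ' : L2Bdry} (h : IsTrace u γ) (h' : IsTrace u γ') : γ = γ' := by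
  have := h.add (h'.smul (-1))
  simp only [neg_smul, one_smul, add_neg_cancel] at this
  exact sub_eq_zero.1 (by simpa [sub_eq_add_neg] using this.eq_zero)

lemma isTrace_iff {u : L2I} {U : ℝ → ℂ} (hU : ContinuousOn U (Icc 0 1)) (hu : u =ᵐ[volI] U)
    {γ : L2Bdry} : IsTrace u γ ↔ γ = !₂[U 0, U 1] := by
  have h : IsTrace u !₂[U 0, U 1] := ⟨U, hU, hu, by simp, by simp⟩
  exact ⟨fun h' => h'.unique h, fun h' => h' ▸ h⟩

/-- Green's formula on the interval. -/
lemma inner_add_inner_eq {u u' v dv : L2I} {U V : ℝ → ℂ} (hU : IsPrimitive U u')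
    (hu : u =ᵐ[volI] U) (hV : IsPrimitive V dv) (hv : v =ᵐ[volI] V) :
    inner ℂ u dv + inner ℂ u' v = inner ℂ (!₂[U 0, U 1] : L2Bdry) !₂[-V 0, V 1] := by
  have h := (hU.star.mul hV).integral_eq_sub
  rw [L2.inner_def, L2.inner_def, ← integral_add (L2.integrable_inner u dv)
    (L2.integrable_inner u' v)]
  simp only [PiLp.inner_apply, Fin.sum_univ_two, RCLike.inner_apply]
  simp only [Pi.mul_apply, Pi.add_apply] at h
  convert h using 1
  · refine integral_congr_ae ?_
    filter_upwards [hu, hv] with x h1 h2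
    rw [h1, h2]
    ring
  · simp
    ring

/-- Affine functions realise every pair of boundary values, so Green's formula leaves only one
candidate for the normal trace. -/
lemma isNormalTrace_iff {v dv : L2I} {V : ℝ → ℂ} (hV : IsPrimitive V dv) (hv : v =ᵐ[volI] V)
    {h : L2Bdry} : IsNormalTrace v dv h ↔ h = !₂[-V 0, V 1] := by
  constructor
  · intro H
    refine ext_inner_left ℂ fun γ => ?_
    have hU : IsPrimitive (fun x : ℝ => γ 0 + (γ 1 - γ 0) * (x : ℂ)) (fun _ => γ 1 - γ 0) := by
      refine IsPrimitive.of_hasDerivAt (fun x => ?_) continuous_const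
      simpa using ((hasDerivAt_id x).ofReal_comp.const_mul (γ 1 - γ 0)).const_add (γ 0)
    have hUm := memLp_of_continuousOn hU.continuousOn
    have hcm : MemLp (fun _ : ℝ => γ 1 - γ 0) 2 volI := memLp_const _
    have hU' := hU.congr_ae hcm.coeFn_toLp.symm
    have hγ : (!₂[γ 0 + (γ 1 - γ 0) * ((0 : ℝ) : ℂ), γ 0 + (γ 1 - γ 0) * ((1 : ℝ) : ℂ)] : L2Bdry)
        = γ := by
      ext j
      fin_cases j <;> simp
    have h1 := inner_add_inner_eq hU' hUm.coeFn_toLp hV hv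
    rw [hγ] at h1
    rw [← h1]
    exact (H _ _ γ (HasWeakDeriv.of_isPrimitive hU' hUm.coeFn_toLp)
      ((isTrace_iff hU.continuousOn hUm.coeFn_toLp).2 hγ.symm)).symm
  · rintro rfl u u' γ hu hγ
    obtain ⟨U, hU, huU⟩ := hu.exists_isPrimitive
    rw [(isTrace_iff hU.continuousOn huU).1 hγ]
    exact inner_add_inner_eq hU huU hV hv

/-- In dimension one every square integrable function is a gradient, so the velocity component of a
state is unconstrained. -/
lemma mem_gradSpace (v : L2I) : v ∈ gradSpace := by
  have h := isPrimitive_integral v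
  have hm := memLp_of_continuousOn h.continuousOn
  exact ⟨hm.toLp _, HasWeakDeriv.of_isPrimitive h hm.coeFn_toLp⟩

/-! ### States, their components, and the wave operator on representatives -/

variable {ν : Measure ℝ≥0}

/-- The state with given components. -/
def mkState (p v : L2I) (ψ : L2Memory ν) : StateSpace ν :=
  WithLp.toLp 2 (p, WithLp.toLp 2 (⟨v, mem_gradSpace v⟩, ψ))

@[simp] lemma pressure_mkState (p v : L2I) (ψ : L2Memory ν) : pressure (mkState p v ψ) = p := rfl
@[simp] lemma velocity_mkState (p v : L2I) (ψ : L2Memory ν) : velocity (mkState p v ψ) = v := rfl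
@[simp] lemma memory_mkState (p v : L2I) (ψ : L2Memory ν) : memory (mkState p v ψ) = ψ := rfl

lemma norm_sq_state (x : StateSpace ν) :
    ‖x‖ ^ 2 = ‖pressure x‖ ^ 2 + (‖velocity x‖ ^ 2 + ‖memory x‖ ^ 2) := by
  rw [WithLp.prod_norm_sq_eq_of_L2, WithLp.prod_norm_sq_eq_of_L2]
  rfl

lemma norm_pressure_le (x : StateSpace ν) : ‖pressure x‖ ≤ ‖x‖ := by
  refine abs_le_of_sq_le_sq' ?_ (norm_nonneg _) |>.2
  nlinarith [norm_sq_state x, sq_nonneg ‖velocity x‖, sq_nonneg ‖memory x‖]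

lemma norm_velocity_le (x : StateSpace ν) : ‖velocity x‖ ≤ ‖x‖ := by
  refine abs_le_of_sq_le_sq' ?_ (norm_nonneg _) |>.2
  nlinarith [norm_sq_state x, sq_nonneg ‖pressure x‖, sq_nonneg ‖memory x‖]

lemma norm_memory_le (x : StateSpace ν) : ‖memory x‖ ≤ ‖x‖ := by
  refine abs_le_of_sq_le_sq' ?_ (norm_nonneg _) |>.2
  nlinarith [norm_sq_state x, sq_nonneg ‖pressure x‖, sq_nonneg ‖velocity x‖]

lemma norm_state_le (x : StateSpace ν) : ‖x‖ ≤ ‖pressure x‖ + ‖velocity x‖ + ‖memory x‖ := by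
  refine abs_le_of_sq_le_sq' ?_ (by positivity) |>.2
  nlinarith [norm_sq_state x, norm_nonneg (pressure x), norm_nonneg (velocity x),
    norm_nonneg (memory x), mul_nonneg (norm_nonneg (pressure x)) (norm_nonneg (velocity x)),
    mul_nonneg (norm_nonneg (pressure x)) (norm_nonneg (memory x)),
    mul_nonneg (norm_nonneg (velocity x)) (norm_nonneg (memory x))]

/-- The wave operator in terms of the absolutely continuous representatives of pressure and
velocity. -/
lemma isWaveImage_iff {x z : StateSpace ν} : IsWaveImage x z ↔ ∃ P V : ℝ → ℂ,
    IsPrimitive P (velocity z) ∧ IsPrimitive V (pressure z) ∧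
    pressure x =ᵐ[volI] P ∧ velocity x =ᵐ[volI] V ∧
    (∀ᵐ τ ∂(ν.restrict (Ioi 0)),
      memory z τ = ((τ : ℝ) : ℂ) • memory x τ - (!₂[P 0, P 1] : L2Bdry)) ∧
    Integrable (memory x) (ν.restrict (Ioi 0)) ∧
    ∫ τ, memory x τ ∂(ν.restrict (Ioi 0)) = !₂[-V 0, V 1] := by
  constructor
  · intro h
    obtain ⟨P, hP, hp⟩ := h.grad_pressure.exists_isPrimitive
    obtain ⟨V, hV, hv⟩ := h.div_velocity.exists_isPrimitive
    obtain ⟨γ, hγ, he⟩ := h.memory_eq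
    rw [(isTrace_iff hP.continuousOn hp).1 hγ] at he
    exact ⟨P, V, hP, hV, hp, hv, he, h.memory_integrable, (isNormalTrace_iff hV hv).1 h.boundary⟩
  · rintro ⟨P, V, hP, hV, hp, hv, he, hi, hb⟩
    exact ⟨.of_isPrimitive hV hv, .of_isPrimitive hP hp,
      ⟨_, (isTrace_iff hP.continuousOn hp).2 rfl, he⟩, hi, (isNormalTrace_iff hV hv).2 hb⟩

instance : IsProbabilityMeasure volI := ⟨by simp⟩

lemma integral_norm_le_norm (f : L2I) : ∫ t, ‖f t‖ ∂volI ≤ ‖f‖ := by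
  rw [Lp.norm_def, integral_norm_eq_lintegral_enorm (Lp.aestronglyMeasurable f),
    ← eLpNorm_one_eq_lintegral_enorm]
  exact ENNReal.toReal_mono (Lp.eLpNorm_ne_top f)
    (eLpNorm_le_eLpNorm_of_exponent_le (by norm_num) (Lp.aestronglyMeasurable f))

lemma norm_L2I_le {u : L2I} {U : ℝ → ℂ} (hu : u =ᵐ[volI] U) {C : ℝ} (hC : 0 ≤ C)
    (h : ∀ x ∈ Icc (0 : ℝ) 1, ‖U x‖ ≤ C) : ‖u‖ ≤ C := by
  have := Lp.norm_le_of_ae_bound (f := u) hC (by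
    filter_upwards [hu, ae_restrict_mem measurableSet_Ioo] with x h1 h2
    rw [h1]
    exact h x (Ioo_subset_Icc_self h2))
  simpa [measureUnivNNReal] using this

/-! ### The memory symbol and the boundary impedance -/

/-- The symbol `1 / (τ + iσ)` of the memory equation at frequency `σ`. -/
def memKernel (σ : ℝ) (τ : ℝ≥0) : ℂ := (((τ : ℝ) : ℂ) + Complex.I * σ)⁻¹

/-- The boundary impedance `∫ 1 / (τ + iσ) dm(τ)`. -/
def impedance (m : Measure ℝ≥0) (σ : ℝ) : ℂ := ∫ τ, memKernel σ τ ∂m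

lemma memKernel_denom_ne_zero {σ : ℝ} (hσ : σ ≠ 0) (τ : ℝ≥0) :
    ((τ : ℝ) : ℂ) + Complex.I * σ ≠ 0 := by
  intro h
  have := congrArg Complex.im h
  simp at this
  exact hσ this

lemma memKernel_re (σ : ℝ) (τ : ℝ≥0) : (memKernel σ τ).re = τ / ((τ : ℝ) ^ 2 + σ ^ 2) := by
  simp [memKernel, Complex.inv_re, Complex.normSq_apply, sq]

lemma measurable_memKernel (σ : ℝ) : Measurable (memKernel σ) := by
  unfold memKernel
  fun_prop

lemma norm_memKernel_le_inv (σ : ℝ) {τ : ℝ≥0} (hτ : 0 < τ) : ‖memKernel σ τ‖ ≤ (τ : ℝ)⁻¹ := by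
  rw [memKernel, norm_inv]
  refine inv_anti₀ (by exact_mod_cast hτ) ?_
  have := Complex.abs_re_le_norm (((τ : ℝ) : ℂ) + Complex.I * σ)
  simpa using this

lemma norm_memKernel_le_one {σ : ℝ} (hσ : 1 ≤ |σ|) (τ : ℝ≥0) : ‖memKernel σ τ‖ ≤ 1 := by
  rw [memKernel, norm_inv]
  refine inv_le_one_of_one_le₀ ?_
  have := Complex.abs_im_le_norm (((τ : ℝ) : ℂ) + Complex.I * σ)
  simp at this
  linarith

variable {m : Measure ℝ≥0} {E : Type*} [NormedAddCommGroup E] [NormedSpace ℂ E]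

lemma memLp_memKernel_smul {σ : ℝ} (hσ : 1 ≤ |σ|) (h : Lp E 2 m) :
    MemLp (fun τ => memKernel σ τ • h τ) 2 m := by
  refine (Lp.memLp h).mono ((measurable_memKernel σ).aestronglyMeasurable.smul
    (Lp.aestronglyMeasurable h)) (Filter.Eventually.of_forall fun τ => ?_)
  rw [norm_smul]
  exact mul_le_of_le_one_left (norm_nonneg _) (norm_memKernel_le_one hσ τ)

section
variable (h0 : ∀ᵐ τ ∂m, 0 < τ) (hi : Integrable (fun τ : ℝ≥0 => (τ : ℝ)⁻¹) m)
include h0 hi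

lemma integrable_memKernel (σ : ℝ) : Integrable (memKernel σ) m := by
  refine hi.mono' (measurable_memKernel σ).aestronglyMeasurable ?_
  filter_upwards [h0] with τ hτ using norm_memKernel_le_inv σ hτ

lemma norm_impedance_le (σ : ℝ) : ‖impedance m σ‖ ≤ ∫ τ : ℝ≥0, (τ : ℝ)⁻¹ ∂m := by
  refine norm_integral_le_of_norm_le hi ?_
  filter_upwards [h0] with τ hτ using norm_memKernel_le_inv σ hτ

lemma impedance_re (σ : ℝ) :
    (impedance m σ).re = ∫ τ : ℝ≥0, (τ : ℝ) / ((τ : ℝ) ^ 2 + σ ^ 2) ∂m := by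
  simp_rw [← memKernel_re]
  exact (integral_re (integrable_memKernel h0 hi σ)).symm

lemma integrable_memKernel_re (σ : ℝ) :
    Integrable (fun τ : ℝ≥0 => (τ : ℝ) / ((τ : ℝ) ^ 2 + σ ^ 2)) m := by
  simp_rw [← memKernel_re]
  exact (integrable_memKernel h0 hi σ).re

lemma impedance_re_pos (hm : m ≠ 0) (σ : ℝ) : 0 < (impedance m σ).re := by
  rw [impedance_re h0 hi]
  have hpos : ∀ᵐ τ ∂m, 0 < ((τ : ℝ≥0) : ℝ) / ((τ : ℝ) ^ 2 + σ ^ 2) := by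
    filter_upwards [h0] with τ hτ
    have : (0 : ℝ) < τ := by exact_mod_cast hτ
    positivity
  rw [integral_pos_iff_support_of_nonneg_ae (hpos.mono fun _ h => h.le)
    (integrable_memKernel_re h0 hi σ)]
  refine pos_iff_ne_zero.2 fun h => hm ?_
  rw [← Measure.measure_univ_eq_zero]
  refine measure_mono_null (fun τ _ => ?_) (measure_union_null h (ae_iff.1 hpos))
  by_cases h' : 0 < ((τ : ℝ≥0) : ℝ) / ((τ : ℝ) ^ 2 + σ ^ 2)
  · exact Or.inl h'.ne'
  · exact Or.inr h'

/-- Monotone already under the integral. This lets the value at `s` control all frequencies up to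
`s`. -/
lemma impedance_re_anti {σ s : ℝ} (h : |σ| ≤ |s|) : (impedance m s).re ≤ (impedance m σ).re := by
  rw [impedance_re h0 hi, impedance_re h0 hi]
  refine integral_mono_ae (integrable_memKernel_re h0 hi s) (integrable_memKernel_re h0 hi σ) ?_
  filter_upwards [h0] with τ hτ
  have : (0 : ℝ) < τ := by exact_mod_cast hτ
  have h2 := sq_le_sq.2 h
  change (τ : ℝ) / ((τ : ℝ) ^ 2 + s ^ 2) ≤ (τ : ℝ) / ((τ : ℝ) ^ 2 + σ ^ 2)
  gcongr

/-- Pointwise `τ² + s² ≤ c² (τ² + σ²)`. It transfers a bound at a resonant frequency `σ` to a nearby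
endpoint `s`. -/
lemma impedance_re_le_mul {σ s c : ℝ} (hc : 1 ≤ c) (h : |s| ≤ c * |σ|) :
    (impedance m σ).re ≤ c ^ 2 * (impedance m s).re := by
  rw [impedance_re h0 hi, impedance_re h0 hi, ← integral_const_mul]
  refine integral_mono_ae (integrable_memKernel_re h0 hi σ)
    ((integrable_memKernel_re h0 hi s).const_mul _) ?_
  filter_upwards [h0] with τ hτ
  have hτ' : (0 : ℝ) < τ := by exact_mod_cast hτ
  have h2 : s ^ 2 ≤ c ^ 2 * σ ^ 2 := by
    rw [← mul_pow, sq_le_sq, abs_mul, abs_of_pos (by linarith : 0 < c)]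
    exact h
  have h3 : (1 : ℝ) ≤ c ^ 2 := one_le_pow₀ hc
  have h4 : (τ : ℝ) ^ 2 ≤ c ^ 2 * (τ : ℝ) ^ 2 := le_mul_of_one_le_left (sq_nonneg _) h3
  change (τ : ℝ) / ((τ : ℝ) ^ 2 + σ ^ 2) ≤ c ^ 2 * ((τ : ℝ) / ((τ : ℝ) ^ 2 + s ^ 2))
  rw [← mul_div_assoc, div_le_div_iff₀ (by positivity) (by positivity)]
  nlinarith

lemma tendsto_impedance_atTop : Filter.Tendsto (impedance m) Filter.atTop (nhds 0) := by
  have := tendsto_integral_filter_of_dominated_convergence (μ := m) (F := memKernel)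
    (l := Filter.atTop) (f := fun _ => 0) _
    (Filter.Eventually.of_forall fun σ => (measurable_memKernel σ).aestronglyMeasurable)
    (Filter.Eventually.of_forall fun σ => h0.mono fun τ hτ => norm_memKernel_le_inv σ hτ) hi
    (Filter.Eventually.of_forall fun τ => by
      rw [tendsto_zero_iff_norm_tendsto_zero]
      refine squeeze_zero' (Filter.Eventually.of_forall fun _ => norm_nonneg _) ?_
        (tendsto_inv_atTop_zero (𝕜 := ℝ))
      filter_upwards [Filter.eventually_gt_atTop 0] with σ hσ
      rw [memKernel, norm_inv]
      refine inv_anti₀ hσ ?_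
      have := Complex.abs_im_le_norm (((τ : ℝ) : ℂ) + Complex.I * σ)
      simp [abs_of_pos hσ] at this
      exact this)
  rw [integral_zero] at this
  exact this

lemma continuous_impedance : Continuous (impedance m) := by
  refine continuous_of_dominated (fun σ => (measurable_memKernel σ).aestronglyMeasurable)
    (fun σ => h0.mono fun τ hτ => norm_memKernel_le_inv σ hτ) hi ?_
  filter_upwards [h0] with τ hτ
  unfold memKernel
  refine Continuous.inv₀ (by fun_prop) fun σ h => ?_
  have := congrArg Complex.re h
  simp at this
  exact hτ.ne' this

lemma memLp_memKernel {σ : ℝ} (hσ : 1 ≤ |σ|) : MemLp (memKernel σ) 2 m := by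
  rw [memLp_two_iff_integrable_sq_norm (measurable_memKernel σ).aestronglyMeasurable]
  refine (integrable_memKernel h0 hi σ).norm.mono'
    ((measurable_memKernel σ).norm.pow_const 2).aestronglyMeasurable
    (Filter.Eventually.of_forall fun τ => ?_)
  rw [Real.norm_of_nonneg (by positivity), sq]
  exact mul_le_of_le_one_left (norm_nonneg _) (norm_memKernel_le_one hσ τ)

/-- Of the two factors in `|memKernel|²`, one is bounded by 1 and the other by `τ⁻¹`; the bound is
uniform in `σ`. -/
lemma norm_toLp_memKernel_le {σ : ℝ} (hσ : 1 ≤ |σ|) :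
    ‖(memLp_memKernel h0 hi hσ).toLp‖ ≤ √(∫ τ : ℝ≥0, (τ : ℝ)⁻¹ ∂m) := by
  have hρ := memLp_memKernel h0 hi hσ
  refine Real.le_sqrt_of_sq_le ?_
  rw [Lp.norm_toLp, hρ.eLpNorm_eq_integral_rpow_norm (by norm_num) (by norm_num),
    ENNReal.toReal_ofReal (by positivity), ← Real.rpow_natCast, ← Real.rpow_mul (by positivity)]
  simp only [ENNReal.toReal_ofNat, Nat.cast_ofNat, inv_mul_cancel_of_invertible, Real.rpow_one,
    Real.rpow_ofNat]
  refine integral_mono_ae ((memLp_two_iff_integrable_sq_norm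
    (measurable_memKernel σ).aestronglyMeasurable).1 hρ) hi ?_
  filter_upwards [h0] with τ hτ
  calc ‖memKernel σ τ‖ ^ 2 = ‖memKernel σ τ‖ * ‖memKernel σ τ‖ := sq _
    _ ≤ 1 * (τ : ℝ)⁻¹ := mul_le_mul (norm_memKernel_le_one hσ τ) (norm_memKernel_le_inv σ hτ)
      (norm_nonneg _) zero_le_one
    _ = (τ : ℝ)⁻¹ := one_mul _

lemma integrable_memKernel_smul {σ : ℝ} (hσ : 1 ≤ |σ|) (h : Lp E 2 m) :
    Integrable (fun τ => memKernel σ τ • h τ) m :=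
  memLp_one_iff_integrable.1 ((Lp.memLp h).smul (memLp_memKernel h0 hi hσ))

lemma norm_integral_memKernel_smul_le {σ : ℝ} (hσ : 1 ≤ |σ|) (h : Lp E 2 m) :
    ‖∫ τ, memKernel σ τ • h τ ∂m‖ ≤ √(∫ τ : ℝ≥0, (τ : ℝ)⁻¹ ∂m) * ‖h‖ := by
  have hρ := memLp_memKernel h0 hi hσ
  refine (norm_integral_le_integral_norm _).trans ?_
  rw [integral_norm_eq_lintegral_enorm (integrable_memKernel_smul h0 hi hσ h).1,
    ← eLpNorm_one_eq_lintegral_enorm]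
  have h1 := eLpNorm_smul_le_mul_eLpNorm (p := 2) (q := 2) (r := 1)
    (Lp.aestronglyMeasurable h) (measurable_memKernel σ).aestronglyMeasurable
  refine (ENNReal.toReal_mono (ENNReal.mul_ne_top hρ.eLpNorm_ne_top
    (Lp.memLp h).eLpNorm_ne_top) h1).trans ?_
  rw [ENNReal.toReal_mul, ← Lp.norm_def, ← Lp.norm_toLp _ hρ]
  gcongr
  exact norm_toLp_memKernel_le h0 hi hσ

lemma memLp_memKernel_smul_const {σ : ℝ} (hσ : 1 ≤ |σ|) (γ : E) :
    MemLp (fun τ => memKernel σ τ • γ) 2 m :=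
  .of_le_mul (c := ‖γ‖) (memLp_memKernel h0 hi hσ)
    ((measurable_memKernel σ).aestronglyMeasurable.smul_const γ)
    (Filter.Eventually.of_forall fun τ => by rw [norm_smul, mul_comm])

/-- A solution of the memory equation `(τ + iσ) ψ = h + γ`. -/
lemma memLp_memorySol {σ : ℝ} (hσ : 1 ≤ |σ|) (h : Lp E 2 m) (γ : E) :
    MemLp (fun τ => memKernel σ τ • (h τ + γ)) 2 m := by
  simp_rw [smul_add]
  exact (memLp_memKernel_smul hσ h).add
    (memLp_memKernel_smul_const h0 hi hσ γ)

/-- The symbol multiplies `h` by at most 1, while the constant `γ` costs the `L²` norm of the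
symbol. Neither factor depends on `σ`. -/
lemma norm_memorySol_le {σ : ℝ} (hσ : 1 ≤ |σ|) (h ψ : Lp E 2 m) (γ : E)
    (hψ : ∀ᵐ τ ∂m, ψ τ = memKernel σ τ • (h τ + γ)) :
    ‖ψ‖ ≤ ‖h‖ + √(∫ τ : ℝ≥0, (τ : ℝ)⁻¹ ∂m) * ‖γ‖ := by
  have hρ := memLp_memKernel h0 hi hσ
  have hρh := memLp_memKernel_smul hσ h
  have h1 : ‖hρh.toLp‖ ≤ ‖h‖ := by
    refine Lp.norm_le_norm_of_ae_le ?_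
    filter_upwards [hρh.coeFn_toLp] with τ hτ
    rw [hτ, norm_smul]
    exact mul_le_of_le_one_left (norm_nonneg _) (norm_memKernel_le_one hσ τ)
  have h2 : ‖ψ - hρh.toLp‖ ≤ ‖γ‖ * ‖hρ.toLp‖ := by
    refine Lp.norm_le_mul_norm_of_ae_le_mul ?_
    filter_upwards [hρh.coeFn_toLp, hρ.coeFn_toLp, hψ, Lp.coeFn_sub ψ hρh.toLp]
      with τ h3 h4 h5 h6
    rw [h6, Pi.sub_apply, h5, h3, h4, smul_add, add_sub_cancel_left, norm_smul, mul_comm]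
  calc ‖ψ‖ = ‖hρh.toLp + (ψ - hρh.toLp)‖ := by rw [add_sub_cancel]
    _ ≤ ‖hρh.toLp‖ + ‖ψ - hρh.toLp‖ := norm_add_le _ _
    _ ≤ ‖h‖ + ‖γ‖ * ‖hρ.toLp‖ := add_le_add h1 h2
    _ ≤ ‖h‖ + ‖γ‖ * √(∫ τ : ℝ≥0, (τ : ℝ)⁻¹ ∂m) := by
      gcongr
      exact norm_toLp_memKernel_le h0 hi hσ
    _ = _ := by rw [mul_comm ‖γ‖]

lemma integrable_memorySol {σ : ℝ} (hσ : 1 ≤ |σ|) (h : Lp E 2 m) (γ : E) :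
    Integrable (fun τ => memKernel σ τ • (h τ + γ)) m := by
  simp_rw [smul_add]
  exact (integrable_memKernel_smul h0 hi hσ h).add ((integrable_memKernel h0 hi σ).smul_const γ)

lemma integral_memorySol [CompleteSpace E] {σ : ℝ} (hσ : 1 ≤ |σ|) (h : Lp E 2 m) (γ : E) :
    ∫ τ, memKernel σ τ • (h τ + γ) ∂m
      = impedance m σ • γ + ∫ τ, memKernel σ τ • h τ ∂m := by
  simp_rw [smul_add]
  rw [integral_add (integrable_memKernel_smul h0 hi hσ h)
    ((integrable_memKernel h0 hi σ).smul_const γ), integral_smul_const, add_comm, impedance]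

end

/-! ### The Laplace transform of a completely monotonic kernel -/

/-- Tonelli: integrating out `τ` first leaves `k`, which is integrable. All the information on `ν`
comes from slicing this in the other order. -/
lemma IsCompletelyMonotonicWith.integrable_prod {k : ℝ → ℝ} {ν : Measure ℝ≥0}
    [IsLocallyFiniteMeasure ν] (hk : IsCompletelyMonotonicWith k ν) (hi : IntegrableOn k (Ioi 0)) :
    Integrable (fun z : ℝ × ℝ≥0 => Real.exp (-(z.2 * z.1)))
      ((volume.restrict (Ioi 0)).prod ν) := by
  rw [integrable_prod_iff (by fun_prop)]
  constructor
  · filter_upwards [ae_restrict_mem measurableSet_Ioi] with t ht using (hk t ht).1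
  · refine Integrable.congr hi ?_
    filter_upwards [ae_restrict_mem measurableSet_Ioi] with t ht
    simp only [Real.norm_eq_abs, Real.abs_exp]
    exact (hk t ht).2

/-- The slice at `τ = 0` is the constant 1 on a half-line, which is not integrable. -/
lemma IsCompletelyMonotonicWith.ae_pos {k : ℝ → ℝ} {ν : Measure ℝ≥0}
    [IsLocallyFiniteMeasure ν] (hk : IsCompletelyMonotonicWith k ν) (hi : IntegrableOn k (Ioi 0)) :
    ∀ᵐ τ ∂ν, 0 < τ := by
  have h := ((integrable_prod_iff' (by fun_prop)).1 (hk.integrable_prod hi)).1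
  filter_upwards [h] with τ hτ
  refine pos_iff_ne_zero.2 fun h0 => ?_
  simp [h0, integrable_const_iff, isFiniteMeasure_restrict] at hτ

/-- The integral of the slice at `τ` is `τ⁻¹`. -/
lemma IsCompletelyMonotonicWith.integrable_inv {k : ℝ → ℝ} {ν : Measure ℝ≥0}
    [IsLocallyFiniteMeasure ν] (hk : IsCompletelyMonotonicWith k ν) (hi : IntegrableOn k (Ioi 0)) :
    Integrable (fun τ : ℝ≥0 => (τ : ℝ)⁻¹) ν := by
  have h := (hk.integrable_prod hi).integral_prod_right
  refine h.congr ?_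
  filter_upwards [hk.ae_pos hi] with τ hτ
  have hτ' : (0 : ℝ) < τ := by exact_mod_cast hτ
  have := integral_exp_mul_Ioi (a := -(τ : ℝ)) (by linarith) 0
  simp only [neg_mul] at this
  rw [this]
  simp

lemma IsCompletelyMonotonicWith.laplace_eq {k : ℝ → ℝ} {ν : Measure ℝ≥0}
    [IsLocallyFiniteMeasure ν] (hk : IsCompletelyMonotonicWith k ν) (hi : IntegrableOn k (Ioi 0))
    (s : ℝ) : laplace k (Complex.I * s) = impedance ν s := by
  have h1 : laplace k (Complex.I * s) = ∫ t in Ioi (0 : ℝ), ∫ τ : ℝ≥0,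
      Complex.exp (-(Complex.I * s) * t) * (Real.exp (-(τ * t)) : ℂ) ∂ν := by
    refine setIntegral_congr_fun measurableSet_Ioi fun t ht => ?_
    rw [integral_const_mul, (hk t ht).2, integral_complex_ofReal]
  have hint : Integrable (fun z : ℝ × ℝ≥0 =>
      Complex.exp (-(Complex.I * s) * z.1) * (Real.exp (-(z.2 * z.1)) : ℂ))
      ((volume.restrict (Ioi 0)).prod ν) := by
    refine (hk.integrable_prod hi).mono' (by fun_prop) (Filter.Eventually.of_forall fun z => ?_)
    rw [norm_mul, Complex.norm_exp, Complex.norm_real]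
    simp
  rw [h1, integral_integral_swap hint, impedance]
  refine integral_congr_ae ?_
  filter_upwards [hk.ae_pos hi] with τ hτ
  have hτ' : (0 : ℝ) < τ := by exact_mod_cast hτ
  have h2 := integral_exp_mul_complex_Ioi (a := -((τ : ℝ) + Complex.I * s)) (by simpa) 0
  rw [memKernel]
  have h3 : ∀ t : ℝ, Complex.exp (-(Complex.I * s) * t) * (Real.exp (-(τ * t)) : ℂ)
      = Complex.exp (-((τ : ℝ) + Complex.I * s) * t) := by
    intro t
    rw [Complex.ofReal_exp, ← Complex.exp_add]
    congr 1
    push_cast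
    ring
  simp_rw [h3, h2]
  simp only [Complex.ofReal_zero, mul_zero, Complex.exp_zero, neg_div_neg_eq, one_div]

/-! ### Transport equations -/

/-- The plane wave `exp (iσt)`. -/
def planeWave (σ t : ℝ) : ℂ := Complex.exp (Complex.I * σ * t)

lemma norm_planeWave (σ t : ℝ) : ‖planeWave σ t‖ = 1 := by
  simp [planeWave, Complex.norm_exp]

lemma planeWave_neg_mul (σ t : ℝ) : planeWave (-σ) t * planeWave σ t = 1 := by
  rw [planeWave, planeWave, ← Complex.exp_add]
  simp

lemma planeWave_zero (σ : ℝ) : planeWave σ 0 = 1 := by simp [planeWave]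

lemma continuous_planeWave (σ : ℝ) : Continuous (planeWave σ) := by
  unfold planeWave
  fun_prop

lemma isPrimitive_planeWave (σ : ℝ) :
    IsPrimitive (planeWave σ) fun t => Complex.I * σ * planeWave σ t := by
  refine IsPrimitive.of_hasDerivAt (fun t => ?_) ((continuous_planeWave σ).const_mul _)
  have h := ((hasDerivAt_id t).ofReal_comp.const_mul (Complex.I * σ)).cexp
  convert h using 1
  · ext t
    simp [planeWave]
  · simp [planeWave, mul_comm]

lemma integrable_planeWave_mul (σ : ℝ) (b : L2I) :
    Integrable (fun t => planeWave σ t * b t) volI :=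
  (L2I_integrable b).bdd_mul (continuous_planeWave σ).aestronglyMeasurable
    (Filter.Eventually.of_forall fun t => (norm_planeWave σ t).le)

lemma norm_integral_planeWave_mul_le (σ : ℝ) (b : L2I) {x : ℝ} (hx : x ∈ Icc (0 : ℝ) 1) :
    ‖∫ t in (0 : ℝ)..x, planeWave σ t * b t‖ ≤ ‖b‖ := by
  refine le_trans ?_ (integral_norm_le_norm b)
  rw [intervalIntegral.integral_of_le hx.1, integral_Ioc_eq_integral_Ioo]
  refine (norm_integral_le_integral_norm _).trans ?_
  simp_rw [norm_mul, norm_planeWave, one_mul]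
  refine setIntegral_mono_set (L2I_integrable b).norm
    (Filter.Eventually.of_forall fun _ => norm_nonneg _) ?_
  exact (Ioo_subset_Ioo_right hx.2).eventuallyLE

/-- Solutions of `W' + iσ W = b`. -/
lemma IsPrimitive.planeWave_mul_eq {W : ℝ → ℂ} {b : L2I} {σ : ℝ}
    (hW : IsPrimitive W fun t => b t - Complex.I * σ * W t) {x : ℝ} (hx : x ∈ Icc (0 : ℝ) 1) :
    planeWave σ x * W x = W 0 + ∫ t in (0 : ℝ)..x, planeWave σ t * b t := by
  have h := ((isPrimitive_planeWave σ).mul hW).eq_integral x hx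
  simp only [Pi.mul_apply, planeWave_zero, one_mul] at h
  rw [h]
  congr 1
  refine intervalIntegral.integral_congr fun t _ => ?_
  simp only [Pi.add_apply, Pi.mul_apply]
  ring

lemma IsPrimitive.eq_planeWave_mul {W : ℝ → ℂ} {b : L2I} {σ : ℝ}
    (hW : IsPrimitive W fun t => b t - Complex.I * σ * W t) {x : ℝ} (hx : x ∈ Icc (0 : ℝ) 1) :
    W x = planeWave (-σ) x * (W 0 + ∫ t in (0 : ℝ)..x, planeWave σ t * b t) := by
  rw [← hW.planeWave_mul_eq hx, ← mul_assoc, planeWave_neg_mul, one_mul]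

lemma IsPrimitive.norm_le_of_transport {W : ℝ → ℂ} {b : L2I} {σ : ℝ}
    (hW : IsPrimitive W fun t => b t - Complex.I * σ * W t) {x : ℝ} (hx : x ∈ Icc (0 : ℝ) 1) :
    ‖W x‖ ≤ ‖W 0‖ + ‖b‖ := by
  rw [hW.eq_planeWave_mul hx, norm_mul, norm_planeWave, one_mul]
  exact (norm_add_le _ _).trans (add_le_add_right (norm_integral_planeWave_mul_le σ b hx) _)

lemma exists_transport (b : L2I) (σ : ℝ) (c : ℂ) :
    ∃ W : ℝ → ℂ, IsPrimitive W (fun t => b t - Complex.I * σ * W t) ∧ W 0 = c := by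
  have h1 : IsPrimitive (fun x => c + ∫ t in (0 : ℝ)..x, planeWave σ t * b t)
      (fun t => planeWave σ t * b t) :=
    ⟨intervalIntegrable_iff_volI.2 (integrable_planeWave_mul σ b), fun x _ => by simp⟩
  refine ⟨_, ((isPrimitive_planeWave (-σ)).mul h1).congr_ae
    (Filter.Eventually.of_forall fun t => ?_), ?_⟩
  · simp only [Pi.add_apply, Pi.mul_apply, Complex.ofReal_neg]
    linear_combination b t * planeWave_neg_mul σ t
  · simp [planeWave_zero]

/-! ### The boundary system -/

section system
variable {α β ε ε' A B p q : ℂ}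

/-- Cramer's rule, with determinant bounded below by the reverse triangle inequality. In the
application `α, β = 1 ± κ`, `ε, ε' = exp(±iσ)`, and `p, q` are the values of `P ± V` at 0. -/
lemma boundary_system_bound (hε : ‖ε‖ = 1) (hε' : ‖ε'‖ = 1) (h1 : β * q - α * p = A)
    (h2 : β * ε' * p - α * ε * q = B) :
    (‖α‖ ^ 2 - ‖β‖ ^ 2) * ‖p‖ ≤ ‖β‖ * ‖B‖ + ‖α‖ * ‖A‖ ∧
      (‖α‖ ^ 2 - ‖β‖ ^ 2) * ‖q‖ ≤ ‖α‖ * ‖B‖ + ‖β‖ * ‖A‖ := by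
  have hD : ‖α‖ ^ 2 - ‖β‖ ^ 2 ≤ ‖β ^ 2 * ε' - α ^ 2 * ε‖ := by
    have := norm_sub_norm_le (α ^ 2 * ε) (β ^ 2 * ε')
    rwa [norm_mul, norm_mul, hε, hε', norm_pow, norm_pow, mul_one, mul_one, norm_sub_rev] at this
  have hp : (β ^ 2 * ε' - α ^ 2 * ε) * p = β * B + α * ε * A := by
    rw [← h1, ← h2]
    ring
  have hq : (β ^ 2 * ε' - α ^ 2 * ε) * q = α * B + β * ε' * A := by
    rw [← h1, ← h2]
    ring
  constructor
  · refine (mul_le_mul_of_nonneg_right hD (norm_nonneg _)).trans ?_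
    rw [← norm_mul, hp]
    refine (norm_add_le _ _).trans ?_
    simp [hε]
  · refine (mul_le_mul_of_nonneg_right hD (norm_nonneg _)).trans ?_
    rw [← norm_mul, hq]
    refine (norm_add_le _ _).trans ?_
    simp [hε']

lemma exists_boundary_system (hε : ‖ε‖ = 1) (hε' : ‖ε'‖ = 1) (hαβ : 0 < ‖α‖ ^ 2 - ‖β‖ ^ 2)
    (A B : ℂ) : ∃ p q : ℂ, β * q - α * p = A ∧ β * ε' * p - α * ε * q = B := by
  have hD : β ^ 2 * ε' - α ^ 2 * ε ≠ 0 := by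
    have := norm_sub_norm_le (α ^ 2 * ε) (β ^ 2 * ε')
    rw [norm_mul, norm_mul, hε, hε', norm_pow, norm_pow, mul_one, mul_one, norm_sub_rev] at this
    exact norm_pos_iff.1 (hαβ.trans_le this)
  refine ⟨(β * B + α * ε * A) / (β ^ 2 * ε' - α ^ 2 * ε),
    (α * B + β * ε' * A) / (β ^ 2 * ε' - α ^ 2 * ε), ?_, ?_⟩
  · rw [mul_div_assoc', mul_div_assoc', ← sub_div, div_eq_iff hD]
    ring
  · rw [mul_div_assoc', mul_div_assoc', ← sub_div, div_eq_iff hD]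
    ring

end system

/-- This identity is how `Re κ` enters: it is the lower bound for the determinant of the boundary
system, and it also measures the damping of the quasimodes. -/
lemma norm_one_add_sq_sub (z : ℂ) : ‖1 + z‖ ^ 2 - ‖1 - z‖ ^ 2 = 4 * z.re := by
  rw [Complex.sq_norm, Complex.sq_norm, Complex.normSq_apply, Complex.normSq_apply]
  simp
  ring

/-! ### The resolvent equation -/

/-- The resolvent equation `(iσ + 𝒜) x = y` in terms of the travelling waves `P + V` and `P - V`
and the boundary impedance. -/
lemma IsWaveImage.exists_travelling {σ : ℝ} (hσ : 1 ≤ |σ|)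
    (h0 : ∀ᵐ τ ∂(ν.restrict (Ioi 0)), 0 < τ)
    (hi : Integrable (fun τ : ℝ≥0 => (τ : ℝ)⁻¹) (ν.restrict (Ioi 0)))
    {x z y : StateSpace ν} (h : IsWaveImage x z) (hy : (Complex.I * σ) • x + z = y) :
    ∃ P V : ℝ → ℂ, pressure x =ᵐ[volI] P ∧ velocity x =ᵐ[volI] V ∧
      IsPrimitive (P + V)
        (fun t => (pressure y + velocity y) t - Complex.I * σ * (P + V) t) ∧
      IsPrimitive (P - V)
        (fun t => (velocity y - pressure y) t - Complex.I * (-σ : ℝ) * (P - V) t) ∧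
      (∀ᵐ τ ∂(ν.restrict (Ioi 0)),
        memory x τ = memKernel σ τ • (memory y τ + (!₂[P 0, P 1] : L2Bdry))) ∧
      impedance (ν.restrict (Ioi 0)) σ • (!₂[P 0, P 1] : L2Bdry)
        + ∫ τ, memKernel σ τ • memory y τ ∂(ν.restrict (Ioi 0)) = !₂[-V 0, V 1] := by
  obtain ⟨P, V, hP, hV, hp, hv, he, -, hb⟩ := isWaveImage_iff.1 h
  have e1 : pressure y = (Complex.I * σ) • pressure x + pressure z := hy ▸ rfl
  have e2 : velocity y = (Complex.I * σ) • velocity x + velocity z := hy ▸ rfl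
  have e3 : memory y = (Complex.I * σ) • memory x + memory z := hy ▸ rfl
  have f1 : ∀ᵐ t ∂volI, pressure y t = Complex.I * σ * P t + pressure z t := by
    rw [e1]
    filter_upwards [hp, Lp.coeFn_add ((Complex.I * σ) • pressure x) (pressure z),
      Lp.coeFn_smul (Complex.I * σ) (pressure x)] with t h1 h2 h3
    rw [h2, Pi.add_apply, h3, Pi.smul_apply, h1, smul_eq_mul]
  have f2 : ∀ᵐ t ∂volI, velocity y t = Complex.I * σ * V t + velocity z t := by
    rw [e2]
    filter_upwards [hv, Lp.coeFn_add ((Complex.I * σ) • velocity x) (velocity z),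
      Lp.coeFn_smul (Complex.I * σ) (velocity x)] with t h1 h2 h3
    rw [h2, Pi.add_apply, h3, Pi.smul_apply, h1, smul_eq_mul]
  have f3 : ∀ᵐ τ ∂(ν.restrict (Ioi 0)),
      memory x τ = memKernel σ τ • (memory y τ + (!₂[P 0, P 1] : L2Bdry)) := by
    rw [e3]
    filter_upwards [he, Lp.coeFn_add ((Complex.I * σ) • memory x) (memory z),
      Lp.coeFn_smul (Complex.I * σ) (memory x)] with τ h1 h2 h3
    have hd : ((τ : ℝ) : ℂ) + Complex.I * σ ≠ 0 := by
      refine memKernel_denom_ne_zero (fun h => ?_) τ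
      norm_num [h] at hσ
    rw [memKernel, eq_inv_smul_iff₀ hd, h2, Pi.add_apply, h3, Pi.smul_apply, h1]
    module
  refine ⟨P, V, hp, hv, (hP.add hV).congr_ae ?_, (hP.sub hV).congr_ae ?_, f3, ?_⟩
  · filter_upwards [f1, f2, Lp.coeFn_add (pressure y) (velocity y)] with t h1 h2 h3
    rw [h3, Pi.add_apply, Pi.add_apply, Pi.add_apply, h1, h2]
    ring
  · filter_upwards [f1, f2, Lp.coeFn_sub (velocity y) (pressure y)] with t h1 h2 h3
    rw [h3, Pi.sub_apply, Pi.sub_apply, Pi.sub_apply, h1, h2]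
    push_cast
    ring
  · rw [← hb, ← integral_memorySol h0 hi hσ]
    exact (integral_congr_ae f3).symm

lemma exists_resolvent_solution {σ : ℝ} (hσ : 1 ≤ |σ|)
    (h0 : ∀ᵐ τ ∂(ν.restrict (Ioi 0)), 0 < τ)
    (hi : Integrable (fun τ : ℝ≥0 => (τ : ℝ)⁻¹) (ν.restrict (Ioi 0)))
    (hm : ν.restrict (Ioi 0) ≠ 0) (y : StateSpace ν) :
    ∃ x z : StateSpace ν, IsWaveImage x z ∧ (Complex.I * σ) • x + z = y := by
  set m := ν.restrict (Ioi 0)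
  set κ := impedance m σ with hκ
  set H := ∫ τ, memKernel σ τ • memory y τ ∂m with hH
  set F := ∫ t in (0 : ℝ)..1, planeWave σ t * (pressure y + velocity y) t with hF
  set G := ∫ t in (0 : ℝ)..1, planeWave (-σ) t * (velocity y - pressure y) t with hG
  obtain ⟨p, q, h1, h2⟩ := exists_boundary_system (α := 1 + κ) (β := 1 - κ)
    (norm_planeWave σ 1) (norm_planeWave (-σ) 1)
    (by rw [norm_one_add_sq_sub]; linarith [impedance_re_pos h0 hi hm σ]) (2 * H 0)
    -- The two equations are twice the boundary conditions at 0 and 1, with the waves at 1 expressed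
    -- by their values at 0 and the transported sources `F` and `G`.
    (2 * H 1 - (1 - κ) * planeWave (-σ) 1 * F + (1 + κ) * planeWave σ 1 * G)
  obtain ⟨W, hW, rfl⟩ := exists_transport (pressure y + velocity y) σ p
  obtain ⟨W', hW', rfl⟩ := exists_transport (velocity y - pressure y) (-σ) q
  have hW1 := hW.eq_planeWave_mul (x := 1) (by simp)
  have hW'1 := hW'.eq_planeWave_mul (x := 1) (by simp)
  rw [← hF] at hW1
  rw [← hG, neg_neg] at hW'1
  have hP := (hW.add hW').const_smul (1 / 2)
  have hV := (hW.sub hW').const_smul (1 / 2)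
  set P : ℝ → ℂ := (1 / 2 : ℂ) • (W + W') with hPdef
  set V : ℝ → ℂ := (1 / 2 : ℂ) • (W - W') with hVdef
  have hPm := memLp_of_continuousOn hP.continuousOn
  have hVm := memLp_of_continuousOn hV.continuousOn
  have hψm := memLp_memorySol h0 hi hσ (memory y) (!₂[P 0, P 1] : L2Bdry)
  let x : StateSpace ν := mkState (hPm.toLp P) (hVm.toLp V) hψm.toLp
  refine ⟨x, y - (Complex.I * σ) • x, ?_, by abel⟩
  have e1 : pressure (y - (Complex.I * σ) • x) = pressure y - (Complex.I * σ) • hPm.toLp P := rfl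
  have e2 : velocity (y - (Complex.I * σ) • x) = velocity y - (Complex.I * σ) • hVm.toLp V := rfl
  have e3 : memory (y - (Complex.I * σ) • x) = memory y - (Complex.I * σ) • hψm.toLp := rfl
  rw [isWaveImage_iff, e1, e2, e3]
  refine ⟨P, V, hP.congr_ae ?_, hV.congr_ae ?_, hPm.coeFn_toLp, hVm.coeFn_toLp, ?_, ?_, ?_⟩
  · filter_upwards [hVm.coeFn_toLp, Lp.coeFn_sub (velocity y) ((Complex.I * σ) • hVm.toLp V),
      Lp.coeFn_smul (Complex.I * σ) (hVm.toLp V), Lp.coeFn_add (pressure y) (velocity y),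
      Lp.coeFn_sub (velocity y) (pressure y)] with t g1 g2 g3 g4 g5
    have g6 : V t = 1 / 2 * (W t - W' t) := rfl
    rw [g2, Pi.sub_apply, g3]
    simp only [Pi.smul_apply, Pi.add_apply, Pi.sub_apply, g1, g4, g5, g6, smul_eq_mul]
    push_cast
    ring
  · filter_upwards [hPm.coeFn_toLp, Lp.coeFn_sub (pressure y) ((Complex.I * σ) • hPm.toLp P),
      Lp.coeFn_smul (Complex.I * σ) (hPm.toLp P), Lp.coeFn_add (pressure y) (velocity y),
      Lp.coeFn_sub (velocity y) (pressure y)] with t g1 g2 g3 g4 g5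
    have g6 : P t = 1 / 2 * (W t + W' t) := rfl
    rw [g2, Pi.sub_apply, g3]
    simp only [Pi.smul_apply, Pi.add_apply, Pi.sub_apply, g1, g4, g5, g6, smul_eq_mul]
    push_cast
    ring
  · filter_upwards [hψm.coeFn_toLp, Lp.coeFn_sub (memory y) ((Complex.I * σ) • hψm.toLp),
      Lp.coeFn_smul (Complex.I * σ) hψm.toLp] with τ g1 g2 g3
    have hd : ((τ : ℝ) : ℂ) + Complex.I * σ ≠ 0 := by
      refine memKernel_denom_ne_zero (fun h => ?_) τ
      norm_num [h] at hσ
    have g4 : (((τ : ℝ) : ℂ) + Complex.I * σ) • memory x τ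
        = memory y τ + (!₂[P 0, P 1] : L2Bdry) := by
      rw [memory_mkState, g1, memKernel, smul_inv_smul₀ hd]
    rw [add_smul] at g4
    rw [g2, Pi.sub_apply, g3, Pi.smul_apply]
    exact sub_eq_sub_iff_add_eq_add.2 g4.symm
  · exact (integrable_memorySol h0 hi hσ _ _).congr hψm.coeFn_toLp.symm
  · rw [memory_mkState, integral_congr_ae hψm.coeFn_toLp, integral_memorySol h0 hi hσ]
    ext j
    fin_cases j
    · simp [← hκ, ← hH, hPdef, hVdef]
      linear_combination -h1 / 2
    · simp [← hκ, ← hH, hPdef, hVdef]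
      linear_combination -h2 / 2 + (κ - 1) / 2 * hW1 + (κ + 1) / 2 * hW'1

lemma norm_boundary_le (a b : ℂ) : ‖(!₂[a, b] : L2Bdry)‖ ≤ ‖a‖ + ‖b‖ := by
  rw [EuclideanSpace.norm_eq]
  refine Real.sqrt_le_iff.2 ⟨by positivity, ?_⟩
  simp only [Fin.sum_univ_two, Matrix.cons_val_zero, Matrix.cons_val_one]
  nlinarith [mul_nonneg (norm_nonneg a) (norm_nonneg b)]

/-- A priori estimate for the resolvent equation. -/
lemma exists_resolvent_bound
    (h0 : ∀ᵐ τ ∂(ν.restrict (Ioi 0)), 0 < τ)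
    (hi : Integrable (fun τ : ℝ≥0 => (τ : ℝ)⁻¹) (ν.restrict (Ioi 0)))
    (hm : ν.restrict (Ioi 0) ≠ 0) : ∃ C : ℝ, 0 < C ∧ ∀ σ : ℝ, 1 ≤ |σ| →
      ∀ x z : StateSpace ν, IsWaveImage x z →
        ‖x‖ ≤ C / (impedance (ν.restrict (Ioi 0)) σ).re * ‖(Complex.I * σ) • x + z‖ := by
  set m := ν.restrict (Ioi 0)
  set K := ∫ τ : ℝ≥0, (τ : ℝ)⁻¹ ∂m with hK
  have hK0 : 0 ≤ K := integral_nonneg fun τ => by positivity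
  set S := √K with hS
  have hS0 : 0 ≤ S := Real.sqrt_nonneg _
  refine ⟨(2 + 2 * S) * ((1 + K) * (S + (1 + K)) + 2 * K) + K + 1, by positivity, ?_⟩
  intro σ hσ x z hx
  set y := (Complex.I * σ) • x + z with hy
  obtain ⟨P, V, hp, hv, hW, hW', hψ, hb⟩ := hx.exists_travelling hσ h0 hi hy.symm
  set κ := impedance m σ with hκ
  have ha : 0 < κ.re := impedance_re_pos h0 hi hm σ
  have hκK : ‖κ‖ ≤ K := norm_impedance_le h0 hi σ
  have haK : κ.re ≤ K := (Complex.re_le_norm κ).trans hκK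
  set a := κ.re
  set H := ∫ τ, memKernel σ τ • memory y τ ∂m with hH
  set N := ‖y‖ with hN
  have hN0 : 0 ≤ N := norm_nonneg _
  have hHn : ‖H‖ ≤ S * N := (norm_integral_memKernel_smul_le h0 hi hσ (memory y)).trans
    (mul_le_mul_of_nonneg_left (norm_memory_le y) hS0)
  have hH0 : ‖H 0‖ ≤ S * N := (PiLp.norm_apply_le H 0).trans hHn
  have hH1 : ‖H 1‖ ≤ S * N := (PiLp.norm_apply_le H 1).trans hHn
  have hbp : ‖pressure y + velocity y‖ ≤ 2 * N := by
    linarith [norm_add_le (pressure y) (velocity y), norm_pressure_le y, norm_velocity_le y]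
  have hbm : ‖velocity y - pressure y‖ ≤ 2 * N := by
    linarith [norm_sub_le (velocity y) (pressure y), norm_pressure_le y, norm_velocity_le y]
  have hF := norm_integral_planeWave_mul_le σ (pressure y + velocity y) (x := 1) (by simp)
  have hG := norm_integral_planeWave_mul_le (-σ) (velocity y - pressure y) (x := 1) (by simp)
  have hW1 := hW.eq_planeWave_mul (x := 1) (by simp)
  have hW'1 := hW'.eq_planeWave_mul (x := 1) (by simp)
  rw [neg_neg] at hW'1
  set F := ∫ t in (0 : ℝ)..1, planeWave σ t * (pressure y + velocity y) t
  set G := ∫ t in (0 : ℝ)..1, planeWave (-σ) t * (velocity y - pressure y) t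
  have b0 := congrArg (fun w : L2Bdry => w 0) hb
  have b1 := congrArg (fun w : L2Bdry => w 1) hb
  simp only [PiLp.add_apply, PiLp.smul_apply, smul_eq_mul, Matrix.cons_val_zero,
    Matrix.cons_val_one] at b0 b1
  simp only [Pi.add_apply, Pi.sub_apply] at hW1 hW'1
  obtain ⟨hp0, hq0⟩ := boundary_system_bound (α := 1 + κ) (β := 1 - κ) (p := P 0 + V 0)
    (q := P 0 - V 0) (A := 2 * H 0)
    (B := 2 * H 1 - (1 - κ) * planeWave (-σ) 1 * F + (1 + κ) * planeWave σ 1 * G)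
    (norm_planeWave σ 1) (norm_planeWave (-σ) 1)
    (by linear_combination -2 * b0)
    (by linear_combination -2 * b1 - (1 - κ) * hW1 + (1 + κ) * hW'1)
  rw [norm_one_add_sq_sub] at hp0 hq0
  have hα : ‖1 + κ‖ ≤ 1 + K := (norm_add_le _ _).trans (by rw [norm_one]; linarith)
  have hβ : ‖1 - κ‖ ≤ 1 + K := (norm_sub_le _ _).trans (by rw [norm_one]; linarith)
  have hA : ‖2 * H 0‖ ≤ 2 * (S * N) := by
    rw [norm_mul, Complex.norm_ofNat]
    linarith
  have hB : ‖2 * H 1 - (1 - κ) * planeWave (-σ) 1 * F + (1 + κ) * planeWave σ 1 * G‖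
      ≤ 2 * (S * N) + (1 + K) * (2 * N) + (1 + K) * (2 * N) := by
    refine (norm_add_le _ _).trans (add_le_add ((norm_sub_le _ _).trans (add_le_add ?_ ?_)) ?_)
    · rw [norm_mul, Complex.norm_ofNat]
      linarith
    · rw [norm_mul, norm_mul, norm_planeWave, mul_one]
      exact mul_le_mul hβ (hF.trans hbp) (norm_nonneg _) (by linarith)
    · rw [norm_mul, norm_mul, norm_planeWave, mul_one]
      exact mul_le_mul hα (hG.trans hbm) (norm_nonneg _) (by linarith)
  -- A uniform bound for both travelling waves: the value at 0 plus the source. The factor 4 in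
  -- `hrhs` cancels the 4 in the determinant bound `4 Re κ`.
  set T := (1 + K) * (S + (1 + K)) * N / a + 2 * N with hT
  have hrhs : ∀ u w : ℂ, ‖u‖ ≤ 1 + K → ‖w‖ ≤ 1 + K →
      ‖u‖ * ‖2 * H 1 - (1 - κ) * planeWave (-σ) 1 * F + (1 + κ) * planeWave σ 1 * G‖
        + ‖w‖ * ‖2 * H 0‖ ≤ 4 * ((1 + K) * (S + (1 + K)) * N) := by
    intro u w hu hw
    refine (add_le_add (mul_le_mul hu hB (norm_nonneg _) (by linarith))
      (mul_le_mul hw hA (norm_nonneg _) (by linarith))).trans (le_of_eq ?_)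
    ring
  have hWx : ∀ t ∈ Icc (0 : ℝ) 1, ‖P t + V t‖ ≤ T := fun t ht => by
    refine (hW.norm_le_of_transport ht).trans (add_le_add ?_ hbp)
    rw [le_div_iff₀ ha, Pi.add_apply]
    linarith [hrhs _ _ hβ hα]
  have hW'x : ∀ t ∈ Icc (0 : ℝ) 1, ‖P t - V t‖ ≤ T := fun t ht => by
    refine (hW'.norm_le_of_transport ht).trans (add_le_add ?_ hbm)
    rw [le_div_iff₀ ha, Pi.sub_apply]
    linarith [hrhs _ _ hα hβ]
  have hT0 : 0 ≤ T := (norm_nonneg _).trans (hWx 0 (by simp))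
  have hhalf : ‖(1 / 2 : ℂ)‖ = 1 / 2 := by simp
  have hPx : ∀ t ∈ Icc (0 : ℝ) 1, ‖P t‖ ≤ T := fun t ht => by
    have : P t = (1 / 2 : ℂ) * ((P t + V t) + (P t - V t)) := by ring
    rw [this, norm_mul, hhalf]
    have := norm_add_le (P t + V t) (P t - V t)
    linarith [hWx t ht, hW'x t ht]
  have hVx : ∀ t ∈ Icc (0 : ℝ) 1, ‖V t‖ ≤ T := fun t ht => by
    have : V t = (1 / 2 : ℂ) * ((P t + V t) - (P t - V t)) := by ring
    rw [this, norm_mul, hhalf]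
    have := norm_sub_le (P t + V t) (P t - V t)
    linarith [hWx t ht, hW'x t ht]
  have hψn := norm_memorySol_le h0 hi hσ (memory y) (memory x) _ hψ
  have hγ : ‖(!₂[P 0, P 1] : L2Bdry)‖ ≤ 2 * T :=
    (norm_boundary_le _ _).trans (by linarith [hPx 0 (by simp), hPx 1 (by simp)])
  -- Since `Re κ ≤ K`, terms without the factor `1 / Re κ` can be absorbed into those with it.
  have hNa : N ≤ K * N / a := by
    rw [le_div_iff₀ ha]
    nlinarith
  have hNa0 : 0 ≤ N / a := by positivity
  have hTle : T ≤ ((1 + K) * (S + (1 + K)) + 2 * K) * (N / a) := by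
    have : ((1 + K) * (S + (1 + K)) + 2 * K) * (N / a)
      = (1 + K) * (S + (1 + K)) * N / a + 2 * (K * N / a) := by ring
    linarith
  calc ‖x‖ ≤ ‖pressure x‖ + ‖velocity x‖ + ‖memory x‖ := norm_state_le x
    _ ≤ T + T + (N + S * (2 * T)) := by
      refine add_le_add (add_le_add (norm_L2I_le hp hT0 hPx) (norm_L2I_le hv hT0 hVx)) ?_
      exact hψn.trans (add_le_add (norm_memory_le y) (mul_le_mul_of_nonneg_left hγ hS0))
    _ = (2 + 2 * S) * T + N := by ring
    _ ≤ (2 + 2 * S) * (((1 + K) * (S + (1 + K)) + 2 * K) * (N / a)) + (K * N / a + N / a) := by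
      refine add_le_add (mul_le_mul_of_nonneg_left hTle (by positivity)) (by linarith)
    _ = _ := by ring

/-! ### The resolvent as a bounded operator -/

lemma mem_waveOp_graph {x w : StateSpace ν} (h : IsWaveImage x w) :
    ∃ hx : x ∈ (waveOp ν).domain, waveOp ν ⟨x, hx⟩ = w := by
  have h1 : (x, w) ∈ (waveOp ν).graph := by
    rw [waveOp_graph]
    exact h
  obtain ⟨⟨x', hx'⟩, rfl, h2⟩ := (LinearPMap.mem_graph_iff _).1 h1
  exact ⟨hx', h2⟩

lemma isWaveImage_waveOp (x : (waveOp ν).domain) : IsWaveImage (x : StateSpace ν) (waveOp ν x) := by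
  have h : ((x : StateSpace ν), waveOp ν x) ∈ (waveOp ν).graph := LinearPMap.mem_graph _ x
  rw [waveOp_graph] at h
  exact h

lemma IsInverseShift.apply_eq {z : ℂ} {B : StateSpace ν →L[ℂ] StateSpace ν}
    (hB : IsInverseShift (waveOp ν) z B) {x w : StateSpace ν} (h : IsWaveImage x w) :
    B (z • x + w) = x := by
  obtain ⟨hx, rfl⟩ := mem_waveOp_graph h
  exact hB.1 ⟨x, hx⟩

/-- The map `(x, w) ↦ z x + w` on the graph is injective by the a priori bound and surjective by
solvability. Its inverse followed by the first projection is the resolvent, bounded by the same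
estimate. -/
lemma exists_isInverseShift {z : ℂ} {C : ℝ} (hC : 0 ≤ C)
    (hb : ∀ x w : StateSpace ν, IsWaveImage x w → ‖x‖ ≤ C * ‖z • x + w‖)
    (hs : ∀ y : StateSpace ν, ∃ x w, IsWaveImage x w ∧ z • x + w = y) :
    ∃ B : StateSpace ν →L[ℂ] StateSpace ν, IsInverseShift (waveOp ν) z B ∧ ‖B‖ ≤ C := by
  let T : waveGraph ν →ₗ[ℂ] StateSpace ν :=
    (z • LinearMap.fst ℂ _ _ + LinearMap.snd ℂ _ _) ∘ₗ (waveGraph ν).subtype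
  have hT : ∀ g : waveGraph ν, T g = z • g.1.1 + g.1.2 := fun _ => rfl
  have hinj : Function.Injective T := by
    rw [injective_iff_map_eq_zero]
    rintro ⟨⟨x, w⟩, h⟩ h1
    rw [hT] at h1
    have h2 := hb x w h
    simp only at h1
    rw [h1, norm_zero, mul_zero, norm_le_zero_iff] at h2
    subst h2
    rw [smul_zero, zero_add] at h1
    subst h1
    rfl
  have hsurj : Function.Surjective T := fun y => by
    obtain ⟨x, w, h, hy⟩ := hs y
    exact ⟨⟨(x, w), h⟩, hy⟩
  let e := LinearEquiv.ofBijective T ⟨hinj, hsurj⟩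
  let L : StateSpace ν →ₗ[ℂ] StateSpace ν :=
    LinearMap.fst ℂ _ _ ∘ₗ (waveGraph ν).subtype ∘ₗ e.symm.toLinearMap
  have hL : ∀ y, ∃ w, IsWaveImage (L y) w ∧ z • L y + w = y := fun y =>
    ⟨(e.symm y).1.2, (e.symm y).2, e.apply_symm_apply y⟩
  have hLb : ∀ y, ‖L y‖ ≤ C * ‖y‖ := fun y => by
    obtain ⟨w, h, hy⟩ := hL y
    simpa only [hy] using hb _ _ h
  refine ⟨L.mkContinuous C hLb, ⟨fun x => ?_, fun y => ?_⟩, L.mkContinuous_norm_le hC hLb⟩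
  · have h : e ⟨(x, waveOp ν x), isWaveImage_waveOp x⟩ = z • (x : StateSpace ν) + waveOp ν x := rfl
    change (e.symm (z • (x : StateSpace ν) + waveOp ν x)).1.1 = x
    rw [← h, e.symm_apply_apply]
  · obtain ⟨w, h, hy⟩ := hL y
    obtain ⟨hx, rfl⟩ := mem_waveOp_graph h
    exact ⟨hx, hy⟩

/-! ### Quasimodes -/

lemma hasDerivAt_cexp_sub_half (c : ℂ) (t : ℝ) :
    HasDerivAt (fun t : ℝ => Complex.exp (c * (t - 1 / 2))) (c * Complex.exp (c * (t - 1 / 2))) t := by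
  have h := (((hasDerivAt_id t).ofReal_comp.sub_const (1 / 2 : ℂ)).const_mul c).cexp
  simpa [mul_comm] using h

/-- If `μ` is an eigenfrequency for the impedance boundary condition at frequency `σ`, then its
mode is a quasimode of `𝒜` at frequency `σ` with error `|σ - μ|`. -/
lemma exists_quasimode {σ : ℝ} (hσ : 1 ≤ |σ|)
    (h0 : ∀ᵐ τ ∂(ν.restrict (Ioi 0)), 0 < τ)
    (hi : Integrable (fun τ : ℝ≥0 => (τ : ℝ)⁻¹) (ν.restrict (Ioi 0))) {μ : ℂ}
    (hμ : Complex.exp (-(Complex.I * μ)) * (1 - impedance (ν.restrict (Ioi 0)) σ)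
      = 1 + impedance (ν.restrict (Ioi 0)) σ) :
    ∃ x w : StateSpace ν, x ≠ 0 ∧ IsWaveImage x w ∧
      ‖(Complex.I * σ) • x + w‖ ≤ ‖(σ : ℂ) - μ‖ * ‖x‖ := by
  set m := ν.restrict (Ioi 0)
  set κ := impedance m σ with hκ
  set c := Complex.I * μ with hc
  -- Centring the exponentials at the midpoint makes `P` even and `V` odd under `t ↦ 1 - t`, so the
  -- conditions at both endpoints become the single equation `hbc`.
  let e : ℝ → ℂ := fun t => Complex.exp (c * (t - 1 / 2))
  let e' : ℝ → ℂ := fun t => Complex.exp (-c * (t - 1 / 2))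
  have he : Continuous e := by fun_prop
  have he' : Continuous e' := by fun_prop
  have hP : IsPrimitive (fun t => e t + e' t) (fun t => -c * (e' t - e t)) := by
    refine IsPrimitive.of_hasDerivAt (fun t => ?_) (by fun_prop)
    refine ((hasDerivAt_cexp_sub_half c t).add (hasDerivAt_cexp_sub_half (-c) t)).congr_deriv ?_
    simp only [e, e']
    ring
  have hV : IsPrimitive (fun t => e' t - e t) (fun t => -c * (e t + e' t)) := by
    refine IsPrimitive.of_hasDerivAt (fun t => ?_) (by fun_prop)
    refine ((hasDerivAt_cexp_sub_half (-c) t).sub (hasDerivAt_cexp_sub_half c t)).congr_deriv ?_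
    simp only [e, e']
    ring
  set P : ℝ → ℂ := fun t => e t + e' t with hPdef
  set V : ℝ → ℂ := fun t => e' t - e t with hVdef
  have h10 : e 0 = e' 1 := by
    simp only [e, e']
    congr 1
    push_cast
    ring
  have h01 : e' 0 = e 1 := by
    simp only [e, e']
    congr 1
    push_cast
    ring
  have hee : e 1 * e' 1 = 1 := by
    simp only [e, e']
    rw [← Complex.exp_add, ← Complex.exp_zero]
    congr 1
    ring
  have hsq : Complex.exp (-c) = e' 1 * e' 1 := by
    simp only [e']
    rw [← Complex.exp_add]
    congr 1
    push_cast
    ring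
  have hbc : κ * (e 1 + e' 1) = e' 1 - e 1 := by
    rw [hsq] at hμ
    linear_combination (-e 1) * hμ + (e' 1 * (1 - κ)) * hee
  have hPm := memLp_of_continuousOn hP.continuousOn
  have hVm := memLp_of_continuousOn hV.continuousOn
  set γ : L2Bdry := !₂[P 0, P 1] with hγ
  have hψm := memLp_memKernel_smul_const h0 hi hσ γ
  set p : L2I := hPm.toLp P with hp
  set v : L2I := hVm.toLp V with hv
  set ψ : L2Memory ν := hψm.toLp with hψ
  -- The memory component uses the real frequency `σ`, so its residual is zero; only pressure and
  -- velocity see the mismatch `σ - μ`.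
  refine ⟨mkState p v ψ, mkState (-c • p) (-c • v) (-(Complex.I * σ) • ψ), ?_, ?_, ?_⟩
  · intro h
    have hp0 : p = 0 := congrArg pressure h
    have h1 : γ = 0 := ((isTrace_iff hP.continuousOn hPm.coeFn_toLp).2 rfl : IsTrace p γ)
      |> fun h => IsTrace.eq_zero (hp0 ▸ h)
    have h2 : e 1 + e' 1 = 0 := by
      have := congrArg (fun w : L2Bdry => w 1) h1
      simpa [hγ] using this
    have h3 : e' 1 - e 1 = 0 := by rw [← hbc, h2, mul_zero]
    have h4 : e' 1 = 0 := by linear_combination (h2 + h3) / 2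
    exact Complex.exp_ne_zero _ h4
  · rw [isWaveImage_iff]
    simp only [pressure_mkState, velocity_mkState, memory_mkState]
    refine ⟨P, V, hP.congr_ae ?_, hV.congr_ae ?_, hPm.coeFn_toLp, hVm.coeFn_toLp, ?_, ?_, ?_⟩
    · filter_upwards [Lp.coeFn_smul (-c) v, hVm.coeFn_toLp] with t g1 g2
      rw [g1, Pi.smul_apply, g2, smul_eq_mul]
    · filter_upwards [Lp.coeFn_smul (-c) p, hPm.coeFn_toLp] with t g1 g2
      rw [g1, Pi.smul_apply, g2, smul_eq_mul]
    · filter_upwards [Lp.coeFn_smul (-(Complex.I * σ)) ψ, hψm.coeFn_toLp] with τ g1 g2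
      have hd : ((τ : ℝ) : ℂ) + Complex.I * σ ≠ 0 := by
        refine memKernel_denom_ne_zero (fun h => ?_) τ
        norm_num [h] at hσ
      have g3 : (((τ : ℝ) : ℂ) + Complex.I * σ) • ψ τ = γ := by
        rw [g2, memKernel, smul_inv_smul₀ hd]
      rw [g1, Pi.smul_apply, ← hγ, ← g3]
      module
    · exact ((integrable_memKernel h0 hi σ).smul_const γ).congr hψm.coeFn_toLp.symm
    · rw [integral_congr_ae hψm.coeFn_toLp, integral_smul_const]
      change κ • γ = _
      ext j
      fin_cases j
      · simp only [hγ, hPdef, hVdef, h10, h01]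
        simp
        linear_combination hbc
      · simp only [hγ, hPdef, hVdef]
        simp
        linear_combination hbc
  · refine abs_le_of_sq_le_sq' ?_ (by positivity) |>.2
    rw [mul_pow, norm_sq_state, norm_sq_state]
    have g1 : pressure ((Complex.I * σ) • mkState p v ψ
        + mkState (-c • p) (-c • v) (-(Complex.I * σ) • ψ)) = (Complex.I * (σ - μ)) • p := by
      rw [pressure_add, pressure_smul, pressure_mkState, pressure_mkState, ← add_smul, hc]
      congr 1
      ring
    have g2 : velocity ((Complex.I * σ) • mkState p v ψ
        + mkState (-c • p) (-c • v) (-(Complex.I * σ) • ψ)) = (Complex.I * (σ - μ)) • v := by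
      rw [velocity_add, velocity_smul, velocity_mkState, velocity_mkState, ← add_smul, hc]
      congr 1
      ring
    have g3 : memory ((Complex.I * σ) • mkState p v ψ
        + mkState (-c • p) (-c • v) (-(Complex.I * σ) • ψ)) = 0 := by
      rw [memory_add, memory_smul, memory_mkState, memory_mkState, ← add_smul, add_neg_cancel,
        zero_smul]
    rw [g1, g2, g3]
    simp only [pressure_mkState, velocity_mkState, memory_mkState, norm_smul, norm_mul,
      Complex.norm_I, one_mul, norm_zero, mul_pow]
    have : 0 ≤ ‖(σ : ℂ) - μ‖ ^ 2 * ‖ψ‖ ^ 2 := by positivity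
    linarith

/-! ### Resonant frequencies -/

/-- Over the window `σ + f σ` grows by at least `13 - 2π`, which exceeds `2π` because `4π < 13`; so
it meets a multiple of `2π`. -/
lemma exists_resonance {f : ℝ → ℝ} {s : ℝ} (hf : ContinuousOn f (Icc (s - 13) s))
    (hb : ∀ σ ∈ Icc (s - 13) s, |f σ| ≤ Real.pi) :
    ∃ σ ∈ Icc (s - 13) s, ∃ n : ℤ, σ + f σ = 2 * Real.pi * n := by
  have hs : s - 13 ≤ s := by linarith
  have hpi := Real.pi_pos
  set n : ℤ := ⌊(s + f s) / (2 * Real.pi)⌋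
  have h1 : 2 * Real.pi * n ≤ s + f s := by
    have := Int.floor_le ((s + f s) / (2 * Real.pi))
    rw [le_div_iff₀ (by positivity)] at this
    linarith
  have h2 : s + f s < 2 * Real.pi * n + 2 * Real.pi := by
    have := Int.lt_floor_add_one ((s + f s) / (2 * Real.pi))
    rw [div_lt_iff₀ (by positivity)] at this
    linarith
  have h3 := (abs_le.1 (hb (s - 13) (left_mem_Icc.2 hs))).2
  have h4 := (abs_le.1 (hb s (right_mem_Icc.2 hs))).1
  obtain ⟨σ, hσ, h5⟩ := intermediate_value_Icc hs (continuousOn_id.add hf)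
    (show 2 * Real.pi * n ∈ Icc ((id + f : ℝ → ℝ) (s - 13)) ((id + f : ℝ → ℝ) s) from
      ⟨by simp only [Pi.add_apply, id]; linarith [Real.pi_lt_d2], h1⟩)
  exact ⟨σ, hσ, n, h5⟩

/-- The logarithm of the inverse reflection coefficient `(1 + κ) / (1 - κ)`. -/
def logReflection (κ : ℂ) : ℂ := Complex.log (1 + κ) - Complex.log (1 - κ)

lemma exp_logReflection_mul {κ : ℂ} (hκ : ‖κ‖ ≤ 1 / 2) :
    Complex.exp (logReflection κ) * (1 - κ) = 1 + κ := by
  have h1 : 1 + κ ≠ 0 :=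
    Complex.slitPlane_ne_zero (Complex.mem_slitPlane_of_norm_lt_one (by linarith))
  have h2 : 1 - κ ≠ 0 := by
    rw [sub_eq_add_neg]
    exact Complex.slitPlane_ne_zero
      (Complex.mem_slitPlane_of_norm_lt_one (by rw [norm_neg]; linarith))
  rw [logReflection, Complex.exp_sub, Complex.exp_log h1, Complex.exp_log h2, div_mul_cancel₀ _ h2]

lemma abs_logReflection_im_le {κ : ℂ} (hκ : ‖κ‖ ≤ 1 / 2) : |(logReflection κ).im| ≤ Real.pi := by
  have h := abs_le.1 (Complex.abs_re_le_norm κ)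
  have h1 : |Complex.arg (1 + κ)| ≤ Real.pi / 2 :=
    Complex.abs_arg_le_pi_div_two_iff.2 (by simp; linarith [h.1])
  have h2 : |Complex.arg (1 - κ)| ≤ Real.pi / 2 :=
    Complex.abs_arg_le_pi_div_two_iff.2 (by simp; linarith [h.2])
  rw [logReflection, Complex.sub_im, Complex.log_im, Complex.log_im]
  refine (abs_sub _ _).trans ?_
  linarith

/-- Twice the real part is `log (|1 + κ|² / |1 - κ|²)`. By `log t ≤ t - 1` it is at most `4 Re κ /
|1 - κ|²`, and `|1 - κ| ≥ 1/2`. -/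
lemma abs_logReflection_re_le {κ : ℂ} (hκ : ‖κ‖ ≤ 1 / 2) (h0 : 0 < κ.re) :
    |(logReflection κ).re| ≤ 8 * κ.re := by
  have h1 : 1 / 2 ≤ ‖1 - κ‖ := by
    have := norm_sub_norm_le 1 κ
    rw [norm_one] at this
    linarith
  have h2 := norm_one_add_sq_sub κ
  have h3 : ‖1 - κ‖ ≤ ‖1 + κ‖ := by
    refine abs_le_of_sq_le_sq' ?_ (norm_nonneg _) |>.2
    linarith
  have h4 : 0 < ‖1 - κ‖ := by linarith
  have h5 : 0 < ‖1 + κ‖ := by linarith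
  rw [logReflection, Complex.sub_re, Complex.log_re, Complex.log_re,
    abs_of_nonneg (sub_nonneg.2 (Real.log_le_log h4 h3)), ← Real.log_div h5.ne' h4.ne']
  have h6 : 2 * Real.log (‖1 + κ‖ / ‖1 - κ‖) = Real.log ((‖1 + κ‖ / ‖1 - κ‖) ^ 2) := by
    rw [Real.log_pow]
    norm_num
  have h7 := Real.log_le_sub_one_of_pos (show 0 < (‖1 + κ‖ / ‖1 - κ‖) ^ 2 by positivity)
  have h8 : (‖1 + κ‖ / ‖1 - κ‖) ^ 2 - 1 ≤ 16 * κ.re := by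
    rw [div_pow, div_sub_one (by positivity), h2, div_le_iff₀ (by positivity)]
    have h9 : (1 / 2) ^ 2 ≤ ‖1 - κ‖ ^ 2 := pow_le_pow_left₀ (by norm_num) h1 2
    nlinarith
  linarith

lemma continuousAt_logReflection {κ : ℂ} (hκ : ‖κ‖ ≤ 1 / 2) : ContinuousAt logReflection κ := by
  have h1 : 1 + κ ∈ Complex.slitPlane := Complex.mem_slitPlane_of_norm_lt_one (by linarith)
  have h2 : 1 - κ ∈ Complex.slitPlane := by
    rw [sub_eq_add_neg]
    exact Complex.mem_slitPlane_of_norm_lt_one (by rw [norm_neg]; linarith)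
  exact ((continuousAt_const.add continuousAt_id).clog h1).sub
    ((continuousAt_const.sub continuousAt_id).clog h2)

/-- At large frequencies there are quasimodes with error bounded by the real part of the
impedance. -/
lemma exists_quasimode_near (h0 : ∀ᵐ τ ∂(ν.restrict (Ioi 0)), 0 < τ)
    (hi : Integrable (fun τ : ℝ≥0 => (τ : ℝ)⁻¹) (ν.restrict (Ioi 0)))
    (hm : ν.restrict (Ioi 0) ≠ 0) :
    ∃ s₀ : ℝ, 1 < s₀ ∧ ∀ s : ℝ, s₀ ≤ s → ∃ σ : ℝ, 1 ≤ |σ| ∧ |σ| ≤ s ∧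
      ∃ x w : StateSpace ν, x ≠ 0 ∧ IsWaveImage x w ∧
        ‖(Complex.I * σ) • x + w‖
          ≤ 1568 * (impedance (ν.restrict (Ioi 0)) s).re * ‖x‖ := by
  set m := ν.restrict (Ioi 0)
  have hev : ∀ᶠ σ in Filter.atTop, ‖impedance m σ‖ < 1 / 2 := by
    have := (tendsto_impedance_atTop h0 hi).norm
    rw [norm_zero] at this
    exact this.eventually_lt_const (by norm_num)
  obtain ⟨s₁, hs₁⟩ := Filter.eventually_atTop.1 hev
  -- The whole window `[s - 13, s]` then lies where `‖κ‖ ≤ 1/2` and `σ ≥ 1`.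
  refine ⟨max s₁ 1 + 13, by linarith [le_max_right s₁ 1], fun s hs => ?_⟩
  have hsm : ∀ σ ∈ Icc (s - 13) s, ‖impedance m σ‖ ≤ 1 / 2 ∧ 1 ≤ σ := fun σ hσ =>
    ⟨(hs₁ σ (by linarith [hσ.1, le_max_left s₁ 1])).le, by linarith [hσ.1, le_max_right s₁ 1]⟩
  obtain ⟨σ, hσ, n, hn⟩ := exists_resonance (s := s)
    (f := fun σ => (logReflection (impedance m σ)).im)
    (fun σ hσ => (Complex.continuous_im.continuousAt.comp
      ((continuousAt_logReflection (hsm σ hσ).1).comp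
        (continuous_impedance h0 hi).continuousAt)).continuousWithinAt)
    (fun σ hσ => abs_logReflection_im_le (hsm σ hσ).1)
  obtain ⟨hκ, hσ1⟩ := hsm σ hσ
  have habs : |σ| = σ := abs_of_pos (by linarith)
  have hs0 : |s| = s := abs_of_pos (by linarith [hσ.2])
  set l := logReflection (impedance m σ) with hl
  -- The eigenfrequency is `μ = 2πn + i l`. By the choice of `σ` its real part is `σ`, so only `Re
  -- l` remains in `σ - μ`.
  have hexp : Complex.exp (-(Complex.I * (2 * Real.pi * n + Complex.I * l)))
      * (1 - impedance m σ) = 1 + impedance m σ := by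
    rw [← exp_logReflection_mul hκ, ← hl]
    congr 1
    rw [Complex.exp_eq_exp_iff_exists_int]
    refine ⟨-n, ?_⟩
    push_cast
    linear_combination -l * Complex.I_mul_I
  have hdist : ‖(σ : ℂ) - (2 * Real.pi * n + Complex.I * l)‖ ≤ 8 * (impedance m σ).re := by
    have h1 : (σ : ℂ) + l.im = 2 * Real.pi * n := by exact_mod_cast hn
    have h2 : (σ : ℂ) - (2 * Real.pi * n + Complex.I * l) = -(Complex.I * l.re) := by
      rw [← h1]
      nth_rewrite 2 [← Complex.re_add_im l]
      linear_combination -l.im * Complex.I_mul_I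
    rw [h2, norm_neg, norm_mul, Complex.norm_I, one_mul, Complex.norm_real]
    exact abs_logReflection_re_le hκ (impedance_re_pos h0 hi hm σ)
  obtain ⟨x, w, hx, hw, hxw⟩ := exists_quasimode (habs.symm ▸ hσ1) h0 hi hexp
  refine ⟨σ, habs.symm ▸ hσ1, habs.symm ▸ hσ.2, x, w, hx, hw, hxw.trans ?_⟩
  refine mul_le_mul_of_nonneg_right (hdist.trans ?_) (norm_nonneg _)
  -- Here `s ≤ σ + 13 ≤ 14 σ` because `σ ≥ 1`; the final constant is `8 * 14² = 1568`.
  have := impedance_re_le_mul h0 hi (σ := σ) (s := s) (c := 14) (by norm_num)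
    (by rw [habs, hs0]; linarith [hσ.1])
  linarith

end ViscoWave
end

/-! ### The two-sided resolvent estimate -/

theorem mainTheorem3 (k : ℝ → ℝ) (ν : MeasureTheory.Measure ℝ≥0)
    [MeasureTheory.IsLocallyFiniteMeasure ν]
    (hkν : ViscoWave.IsCompletelyMonotonicWith k ν)
    (hk_int : MeasureTheory.IntegrableOn k (Set.Ioi 0))
    (hk_ne : ∃ t : ℝ, 0 < t ∧ k t ≠ 0) :
    ∃ R : ℝ → (ViscoWave.StateSpace ν →L[ℂ] ViscoWave.StateSpace ν),
      (∀ σ : ℝ, 1 ≤ |σ| →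
        ViscoWave.IsInverseShift (ViscoWave.waveOp ν) (Complex.I * σ) (R σ)) ∧
      ∃ c C : ℝ, 0 < c ∧ 0 < C ∧ ∀ s : ℝ, 1 < s →
        0 < (ViscoWave.laplace k (Complex.I * s)).re ∧
        ∃ M : ℝ, IsLUB {r : ℝ | ∃ σ : ℝ, 1 ≤ |σ| ∧ |σ| ≤ s ∧ r = ‖R σ‖} M ∧
          c / (ViscoWave.laplace k (Complex.I * s)).re ≤ M ∧
          M ≤ C / (ViscoWave.laplace k (Complex.I * s)).re := by
  have hres : ν.restrict (Ioi 0) = ν := Measure.restrict_eq_self_of_ae_mem (hkν.ae_pos hk_int)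
  have h0 : ∀ᵐ τ ∂(ν.restrict (Ioi 0)), 0 < τ := by
    rw [hres]
    exact hkν.ae_pos hk_int
  have hi : Integrable (fun τ : ℝ≥0 => (τ : ℝ)⁻¹) (ν.restrict (Ioi 0)) := by
    rw [hres]
    exact hkν.integrable_inv hk_int
  have hm : ν.restrict (Ioi 0) ≠ 0 := by
    rw [hres]
    rintro rfl
    obtain ⟨t, ht, hkt⟩ := hk_ne
    exact hkt (by rw [(hkν t ht).2, integral_zero_measure])
  have hlap : ∀ s : ℝ, ViscoWave.laplace k (Complex.I * s)
      = ViscoWave.impedance (ν.restrict (Ioi 0)) s := fun s => by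
    rw [hkν.laplace_eq hk_int, hres]
  simp only [hlap]
  set a : ℝ → ℝ := fun s => (ViscoWave.impedance (ν.restrict (Ioi 0)) s).re with ha
  have hapos : ∀ s, 0 < a s := ViscoWave.impedance_re_pos h0 hi hm
  obtain ⟨C, hC, hbound⟩ := ViscoWave.exists_resolvent_bound h0 hi hm
  have hex : ∀ σ : ℝ, ∃ B : ViscoWave.StateSpace ν →L[ℂ] ViscoWave.StateSpace ν, 1 ≤ |σ| →
      ViscoWave.IsInverseShift (ViscoWave.waveOp ν) (Complex.I * σ) B ∧ ‖B‖ ≤ C / a σ := by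
    intro σ
    by_cases hσ : 1 ≤ |σ|
    · obtain ⟨B, hB⟩ := ViscoWave.exists_isInverseShift (div_nonneg hC.le (hapos σ).le)
        (hbound σ hσ) (ViscoWave.exists_resolvent_solution hσ h0 hi hm)
      exact ⟨B, fun _ => hB⟩
    · exact ⟨0, fun h => absurd h hσ⟩
  choose R hR using hex
  obtain ⟨s₀, hs₀, hmode⟩ := ViscoWave.exists_quasimode_near h0 hi hm
  have hR1 : 0 < ‖R 1‖ := by
    obtain ⟨-, -, -, x, w, hx, hw, -⟩ := hmode s₀ le_rfl
    refine (R 1).opNorm_nonneg.lt_of_ne' fun h => hx ?_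
    have := (R 1).le_opNorm ((Complex.I * (1 : ℝ)) • x + w)
    rwa [(hR 1 (by simp)).1.apply_eq hw, h, zero_mul, norm_le_zero_iff] at this
  -- The first entry of the minimum serves `s ≥ s₀` through quasimodes. The second serves `1 < s <
  -- s₀`, where `σ = 1` is admissible and `a s₀ ≤ a s`.
  refine ⟨R, fun σ hσ => (hR σ hσ).1, min (1 / 1568) (‖R 1‖ * a s₀), C,
    lt_min (by norm_num) (mul_pos hR1 (hapos s₀)), hC, fun s hs => ⟨hapos s, ?_⟩⟩
  set A := {r : ℝ | ∃ σ : ℝ, 1 ≤ |σ| ∧ |σ| ≤ s ∧ r = ‖R σ‖} with hA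
  have hAub : C / a s ∈ upperBounds A := by
    rintro _ ⟨σ, hσ1, hσ2, rfl⟩
    refine (hR σ hσ1).2.trans (div_le_div_of_nonneg_left hC.le (hapos s) ?_)
    exact ViscoWave.impedance_re_anti h0 hi (hσ2.trans (le_abs_self s))
  have hAne : A.Nonempty := ⟨‖R 1‖, 1, by simp, by simpa using hs.le, rfl⟩
  have hlub := isLUB_csSup hAne ⟨_, hAub⟩
  refine ⟨sSup A, hlub, ?_, hlub.2 hAub⟩
  rcases le_or_gt s₀ s with h | h
  · obtain ⟨σ, hσ1, hσ2, x, w, hx, hw, hxw⟩ := hmode s h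
    refine le_trans ?_ (hlub.1 ⟨σ, hσ1, hσ2, rfl⟩)
    rw [div_le_iff₀ (hapos s)]
    refine (min_le_left _ _).trans ?_
    have h1 := (R σ).le_opNorm ((Complex.I * σ) • x + w)
    rw [(hR σ hσ1).1.apply_eq hw] at h1
    have h2 := h1.trans (mul_le_mul_of_nonneg_left hxw (R σ).opNorm_nonneg)
    have h3 : 1 ≤ ‖R σ‖ * (1568 * a s) := by
      refine le_of_mul_le_mul_right ?_ (norm_pos_iff.2 hx)
      linarith
    linarith
  · refine le_trans ?_ (hlub.1 ⟨1, by simp, by simpa using hs.le, rfl⟩)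
    rw [div_le_iff₀ (hapos s)]
    refine (min_le_right _ _).trans (mul_le_mul_of_nonneg_left ?_ (R 1).opNorm_nonneg)
    refine ViscoWave.impedance_re_anti h0 hi ?_
    rw [abs_of_pos (by linarith), abs_of_pos (by linarith)]
    exact h.le
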